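/- Let $S^2\subset\mathbb R^3$ be the unit sphere with the round metric and its surface measure $dV$ (total mass $4\pi$), and let $\mathrm{SL}(3)$ be the group of real $3\times 3$ matrices of determinant one. For an integrable function $f:S^2\to\mathbb R$, a weak gradient of $f$ is an integrable tangent vector field $\tilde\nabla f$ with $\int f\,\mathrm{div}X\,dV=-\int\langle\tilde\nabla f,X\rangle\,dV$ for every smooth tangent vector field $X$, and a weak Hessian of $f$ is an integrable covariant $2$-tensor field $\tilde\nabla^2 f$ with $\int f\,\mathrm{div}\,\mathrm{div}\,T\,dV=\int\langle\tilde\nabla^2 f,T\rangle\,dV$ for every smooth $2$-tensor field $T$, where $\mathrm{div}$ is the trace of the Levi-Civita covariant derivative, $(\mathrm{div}\,T)(v)=\sum_i(\nabla_{e_i}T)(e_i,v)$ for an orthonormal basis $(e_i)$ of the tangent plane. Let $W^{2,2}(S^2)$ be the set of square-integrable functions on $S^2$ that have a square-integrable weak gradient and a square-integrable weak Hessian. For $H\in\mathrm{SL}(3)$ and $x\in S^2$ put $\rho_H(x)=\rho(H,x)=H^{-1}x/|H^{-1}x|$, and for a function $I$ on $S^2$ put $\mu(H,I)=I\circ\rho_{H^{-1}}$.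 Then $\mu$ is a right group action of $\mathrm{SL}(3)$ on $W^{2,2}(S^2)$: for all $I\in W^{2,2}(S^2)$ and $G,H\in\mathrm{SL}(3)$, $$\mu(H,I)\in W^{2,2}(S^2),\qquad \mu(I_3,I)=I,\qquad \mu(G,\mu(H,I))=\mu(HG,I).$$ The same holds when functions in $W^{2,2}(S^2)$ are identified if they agree almost everywhere ($\mu$ is well defined on these classes). Moreover, for every $H\in\mathrm{SL}(3)$ there are constants $M_0,M_1,M_2>0$, depending only on $H$, such that for all $I\in W^{2,2}(S^2)$ $$\|\mu(H,I)\|^2\le M_0\|I\|^2,\qquad \|\tilde\nabla\mu(H,I)\|^2\le M_1\|\tilde\nabla I\|^2,\qquad \|\tilde\nabla^2\mu(H,I)\|^2\le M_2\big(\|\tilde\nabla^2 I\|^2+\|\tilde\nabla I\|^2\big),$$ where $\|\cdot\|$ is the $L^2(S^2)$ norm of functions, vector fields and $2$-tensor fields. -/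

import Mathlib

open MeasureTheory Metric
open scoped Manifold ContDiff InnerProductSpace

noncomputable section

namespace SphereSobolev

/-- Euclidean three-space. -/
abbrev E3 : Type := EuclideanSpace ℝ (Fin 3)

/-- The unit sphere of Euclidean three-space, with Mathlib's smooth manifold structure. -/
abbrev S2 : Type := sphere (0 : E3) 1

/-- The group of real 3 × 3 matrices of determinant one. -/
abbrev SL3 : Type := Matrix.SpecialLinearGroup (Fin 3) ℝ

/-- The surface measure of the sphere: the total mass is 4π, and in polar angles it is
`sin θ dθ dφ`. -/
def area : Measure S2 := (volume : Measure E3).toSphere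

/-- The point `v / |v|` of the sphere, for `v ≠ 0`. -/
def dirPoint (v : E3) (hv : v ≠ 0) : S2 :=
  ⟨‖v‖⁻¹ • v, by
    rw [mem_sphere_zero_iff_norm, norm_smul, norm_inv, norm_norm,
      inv_mul_cancel₀ (norm_ne_zero_iff.mpr hv)]⟩

theorem toEuclideanLin_ne_zero (H : SL3) (x : S2) :
    Matrix.toEuclideanLin (H : Matrix (Fin 3) (Fin 3) ℝ) (x : E3) ≠ 0 := by
  intro h
  have hx : (x : E3) ≠ 0 := ne_zero_of_mem_unit_sphere x
  have hdet : (H : Matrix (Fin 3) (Fin 3) ℝ).det ≠ 0 := by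
    rw [H.det_coe]; exact one_ne_zero
  have h' : (H : Matrix (Fin 3) (Fin 3) ℝ).mulVec (WithLp.ofLp (x : E3)) = 0 := by
    have := congrArg WithLp.ofLp h
    simpa [Matrix.toLpLin_apply] using this
  have h0 := Matrix.eq_zero_of_mulVec_eq_zero hdet h'
  exact hx (by ext i; simpa using congrFun h0 i)

/-- `ρ(H, x) = H⁻¹ x / |H⁻¹ x|`. -/
def rho (H : SL3) (x : S2) : S2 :=
  dirPoint (Matrix.toEuclideanLin ((H⁻¹ : SL3) : Matrix (Fin 3) (Fin 3) ℝ) (x : E3))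
    (toEuclideanLin_ne_zero H⁻¹ x)

/-- `μ(H, I) = I ∘ ρ_{H⁻¹}`, on arbitrary functions. -/
def mu (H : SL3) (I : S2 → ℝ) : S2 → ℝ := I ∘ rho H⁻¹

/-- Right actions of a group: the identity acts trivially, and acting by `h` and then by `g` is
acting by `h * g`. -/
def IsRightAction {G X : Type*} [Group G] (a : G → X → X) : Prop :=
  (∀ x, a 1 x = x) ∧ ∀ g h x, a g (a h x) = a (h * g) x

/-! Tangent vector fields are maps `X : S2 → E3` with `X x ⟂ x`. A tangent 2-tensor field is a map
`T : S2 → E3 →L[ℝ] E3`, standing for the bilinear forms `T x [u, v] = ⟪T x u, v⟫`, which vanish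
when `u` or `v` is normal to the sphere at `x`. -/

/-- The orthogonal projection `π_x = I - x xᵀ` onto the tangent plane at `x`. -/
def tangentProj (x : S2) : E3 →L[ℝ] E3 :=
  ContinuousLinearMap.id ℝ E3 - (innerSL ℝ (x : E3)).smulRight (x : E3)

/-- The extension of a function on the sphere to `ℝ³ ∖ {0}` that is constant on rays (with the
irrelevant value `0` at the origin). -/
def radialExt {F : Type*} [Zero F] (X : S2 → F) (y : E3) : F :=
  open Classical in if hy : y = 0 then 0 else X (dirPoint y hy)

/-- `X` is a tangent vector field. -/
def IsTangentField (X : S2 → E3) : Prop :=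
  ∀ x : S2, ⟪X x, (x : E3)⟫_ℝ = 0

/-- `T` is a tangent 2-tensor field. -/
def IsTangentTensor (T : S2 → E3 →L[ℝ] E3) : Prop :=
  ∀ x : S2, T x (x : E3) = 0 ∧ ∀ u : E3, ⟪T x u, (x : E3)⟫_ℝ = 0

/-- Covariant derivative `∇_u X` of a tangent vector field at `x`: the projection to the tangent
plane of the Euclidean derivative of an extension of `X`. -/
def covDeriv (X : S2 → E3) (x : S2) (u : E3) : E3 :=
  tangentProj x (fderiv ℝ (radialExt X) (x : E3) u)

/-- Covariant derivative `∇_u T` of a tangent 2-tensor field at `x`. -/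
def covDerivTensor (T : S2 → E3 →L[ℝ] E3) (x : S2) (u : E3) : E3 →L[ℝ] E3 :=
  tangentProj x ∘L fderiv ℝ (radialExt T) (x : E3) u ∘L tangentProj x

/-- The standard basis of three-space. -/
def stdVec (i : Fin 3) : E3 := EuclideanSpace.single i 1

/-- Divergence of a tangent vector field: the trace of `u ↦ ∇_u X` over the tangent plane,
computed as the trace over three-space of that map composed with the projections. -/
def divField (X : S2 → E3) (x : S2) : ℝ :=
  ∑ i : Fin 3, ⟪covDeriv X x (tangentProj x (stdVec i)), tangentProj x (stdVec i)⟫_ℝ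

/-- Divergence of a tangent 2-tensor field: the tangent vector field `∑ᵢ (∇_{eᵢ} T)[eᵢ, ·]`,
where `eᵢ` runs through an orthonormal basis of the tangent plane (equivalently, through the
projections to the tangent plane of an orthonormal basis of three-space). -/
def divTensor (T : S2 → E3 →L[ℝ] E3) (x : S2) : E3 :=
  ∑ i : Fin 3, covDerivTensor T x (tangentProj x (stdVec i)) (tangentProj x (stdVec i))

/-- The inner product of 2-tensors, `∑ᵢⱼ A[eᵢ, eⱼ] B[eᵢ, eⱼ]`. -/
def tensorInner (A B : E3 →L[ℝ] E3) : ℝ :=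
  ∑ i : Fin 3, ⟪A (stdVec i), B (stdVec i)⟫_ℝ

/-- `g` is a weak gradient of `f`: `∫ f div X = - ∫ ⟪g, X⟫` for every smooth tangent vector
field `X` (the sphere being compact, all supports are compact). -/
def IsWeakGradient (f : S2 → ℝ) (g : S2 → E3) : Prop :=
  Integrable f area ∧ Integrable g area ∧ IsTangentField g ∧
    ∀ X : S2 → E3, ContMDiff (𝓡 2) 𝓘(ℝ, E3) ∞ X → IsTangentField X →
      ∫ x, f x * divField X x ∂area = - ∫ x, ⟪g x, X x⟫_ℝ ∂area

/-- `B` is a weak Hessian of `f`: `∫ f div (div T) = ∫ ⟪B, T⟫` for every smooth tangent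
2-tensor field `T`. -/
def IsWeakHessian (f : S2 → ℝ) (B : S2 → E3 →L[ℝ] E3) : Prop :=
  Integrable f area ∧ Integrable B area ∧ IsTangentTensor B ∧
    ∀ T : S2 → E3 →L[ℝ] E3, ContMDiff (𝓡 2) 𝓘(ℝ, E3 →L[ℝ] E3) ∞ T → IsTangentTensor T →
      ∫ x, f x * divField (divTensor T) x ∂area = ∫ x, tensorInner (B x) (T x) ∂area

/-- The functions in `W^{2,2}(S²)`: square-integrable, with a square-integrable weak gradient and
a square-integrable weak Hessian. -/
def W22 : Set (S2 → ℝ) :=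
  {f | MemLp f 2 area ∧ (∃ g, IsWeakGradient f g ∧ MemLp g 2 area) ∧
    ∃ B, IsWeakHessian f B ∧ MemLp B 2 area}

/-- `W^{2,2}(S²)` as a space of classes of functions modulo equality almost everywhere. -/
def W22Class : Set (Lp ℝ 2 area) :=
  {f | (f : S2 → ℝ) ∈ W22}

end SphereSobolev

end

noncomputable section

namespace SphereSobolev

open ContinuousLinearMap (adjoint)
open scoped Pointwise NNReal ENNReal


/-! By `mu_eq`, `mu H I` is `I` composed with the sphere map `x ↦ Hx/|Hx|`, so the action laws are
those of composition. The analytic content is that weak derivatives survive this composition. No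
charts are used: test fields are extended homogeneously to the punctured space, where the map
becomes a linear map `L` and both divergences commute with it (`ediv_map`, `tdiv_map`).

The degrees of homogeneity are chosen to match the Jacobian. A field `a(y) y` with `a` of degree -3
is divergence free, so for a vector field of degree -2 the divergence in space is the spherical
divergence of its tangential part (`divField_tangentProj`). That divergence has degree -3, and
composing a function of degree -3 with `L⁻¹` yields precisely the Jacobian factor `|L⁻¹y|⁻³`
(`HomogOff.apply_symm`, `map_sphereMap_area`). Hence transporting a test field by `L` and projecting
it multiplies its divergence by the Jacobian (`divField_pushField`), and dualizing gives the weak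
gradient `pullGrad`.

For 2-tensors the degree is -1. The transported tensor `L T L*` is no longer tangent, and by
`ediv_tdiv_eq` its normal components add the divergence of a vector field to the double divergence.
Dually, the weak Hessian `pullHess` contains a term linear in the gradient; this is why the gradient
enters the second-order estimate. The bounds follow from pointwise operator-norm estimates and the
bounded Jacobian. They apply to all weak derivatives because these are unique almost everywhere. -/

variable {F : Type*} [NormedAddCommGroup F] [NormedSpace ℝ F]

/-! ### Smooth and homogeneous maps on the punctured space. -/

/-- `V` is smooth away from the origin. -/
def SmoothOff (V : E3 → F) : Prop := ∀ y, y ≠ 0 → ContDiffAt ℝ ∞ V y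

/-- `V` is positively homogeneous of degree `k` away from the origin. -/
def HomogOff (k : ℤ) (V : E3 → F) : Prop :=
  ∀ t : ℝ, 0 < t → ∀ y, y ≠ 0 → V (t • y) = t ^ k • V y

theorem SmoothOff.differentiableAt {V : E3 → F} (hV : SmoothOff V) {y : E3} (hy : y ≠ 0) :
    DifferentiableAt ℝ V y :=
  (hV y hy).differentiableAt (by simp)

theorem SmoothOff.fderiv {V : E3 → F} (hV : SmoothOff V) : SmoothOff (fderiv ℝ V) :=
  fun y hy => (hV y hy).fderiv_right (by simp)

theorem SmoothOff.congr {V W : E3 → F} (hV : SmoothOff V) (h : ∀ y, y ≠ 0 → W y = V y) :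
    SmoothOff W := fun y hy =>
  (hV y hy).congr_of_eventuallyEq (by
    filter_upwards [isOpen_ne.mem_nhds hy] with z hz using h z hz)

theorem fderiv_congr_off {V W : E3 → F} (h : ∀ y, y ≠ 0 → W y = V y) {y : E3} (hy : y ≠ 0) :
    fderiv ℝ W y = fderiv ℝ V y :=
  Filter.EventuallyEq.fderiv_eq (by
    filter_upwards [isOpen_ne.mem_nhds hy] with z hz using h z hz)

/-- Euler's identity: `t ↦ V (t • y)` is differentiated at `t = 1` by the chain rule and by
homogeneity. -/
theorem HomogOff.fderiv_apply_self {V : E3 → F} {k : ℤ} (hk : HomogOff k V) {y : E3} (hy : y ≠ 0)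
    (hV : DifferentiableAt ℝ V y) : fderiv ℝ V y y = (k : ℝ) • V y := by
  have h1 : HasDerivAt (fun t : ℝ => V (t • y)) (fderiv ℝ V y y) 1 := by
    have h := ((hasDerivAt_id (1 : ℝ)).smul_const y)
    have hV' : HasFDerivAt V (fderiv ℝ V y) ((id (1 : ℝ)) • y) := by simpa using hV.hasFDerivAt
    have := HasFDerivAt.comp_hasDerivAt (1 : ℝ) hV' h
    simpa [Function.comp_def] using this
  have h2 : HasDerivAt (fun t : ℝ => t ^ k • V y) ((k : ℝ) • V y) 1 := by
    have := (hasDerivAt_zpow k (1 : ℝ) (Or.inl one_ne_zero)).smul_const (V y)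
    simpa using this
  refine h1.unique (h2.congr_of_eventuallyEq ?_)
  filter_upwards [lt_mem_nhds (zero_lt_one' ℝ)] with t ht using hk t ht y hy

theorem HomogOff.fderiv_apply_self_eq_zero {V : E3 → F} (hk : HomogOff 0 V) {y : E3} (hy : y ≠ 0)
    (hV : DifferentiableAt ℝ V y) : fderiv ℝ V y y = 0 := by
  rw [hk.fderiv_apply_self hy hV, Int.cast_zero, zero_smul]

theorem HomogOff.fderiv {V : E3 → F} {k : ℤ} (hk : HomogOff k V) (hV : SmoothOff V) :
    HomogOff (k - 1) (fderiv ℝ V) := by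
  intro t ht y hy
  have hty : t • y ≠ 0 := smul_ne_zero ht.ne' hy
  have h1 := fderiv_comp_smul (𝕜 := ℝ) (f := V) (x := y) t
  have h2 : _root_.fderiv ℝ (fun z => V (t • z)) y = _root_.fderiv ℝ (fun z => t ^ k • V z) y :=
    fderiv_congr_off (fun z hz => hk t ht z hz) hy
  rw [h2, fderiv_fun_const_smul (hV.differentiableAt hy)] at h1
  rw [zpow_sub_one₀ ht.ne', mul_comm, mul_smul, h1, smul_smul, inv_mul_cancel₀ ht.ne', one_smul]

theorem smoothOff_norm_zpow (k : ℤ) : SmoothOff fun y : E3 => ‖y‖ ^ k := by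
  intro y hy
  have h0 : ContDiffAt ℝ ∞ (fun y : E3 => ‖y‖) y := contDiffAt_norm ℝ hy
  rcases k with k | k
  · simpa using h0.pow k
  · simp only [zpow_negSucc]
    exact (h0.pow (k + 1)).inv (by simpa using hy)

theorem homogOff_norm_zpow (k : ℤ) : HomogOff k fun y : E3 => ‖y‖ ^ k := by
  intro t ht y _
  simp [norm_smul, abs_of_pos ht, mul_zpow]

theorem fderiv_norm_zpow_apply (k : ℤ) {y : E3} (hy : y ≠ 0) (u : E3) :
    fderiv ℝ (fun y : E3 => ‖y‖ ^ k) y u = k * ‖y‖ ^ (k - 2) * ⟪y, u⟫_ℝ := by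
  have hn : ‖y‖ ≠ 0 := norm_ne_zero_iff.mpr hy
  have h1 : HasFDerivAt (fun y : E3 => ‖y‖) (fderiv ℝ (fun y : E3 => ‖y‖) y) y :=
    ((contDiffAt_norm ℝ hy).differentiableAt (n := 1) (by simp)).hasFDerivAt
  have h2 := (hasDerivAt_zpow k ‖y‖ (Or.inl hn)).comp_hasFDerivAt y h1
  -- The derivative of the norm is read off from two expressions for the derivative of its square.
  have h3 := h1.pow 2
  have h4 := h3.unique ((hasStrictFDerivAt_norm_sq y).hasFDerivAt)
  have h5 := congrArg (fun A => A u) h4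
  simp at h5
  have h6 : fderiv ℝ (fun y : E3 => ‖y‖) y u = ‖y‖⁻¹ * ⟪y, u⟫_ℝ := by
    field_simp
    linarith
  have h7 : fderiv ℝ (fun y : E3 => ‖y‖ ^ k) y = _ := h2.fderiv
  rw [h7, smul_apply, h6, show k - 2 = k - 1 - 1 by ring,
    zpow_sub_one₀ hn (k - 1), smul_eq_mul]
  ring

theorem radialExt_of_ne {F : Type*} [Zero F] (X : S2 → F) {y : E3} (hy : y ≠ 0) :
    radialExt X y = X (dirPoint y hy) := by
  simp [radialExt, hy]

theorem dirPoint_coe (x : S2) (hx : (x : E3) ≠ 0) : dirPoint (x : E3) hx = x := by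
  ext1
  simp [dirPoint]

theorem S2.ne_zero (x : S2) : (x : E3) ≠ 0 := ne_zero_of_mem_unit_sphere x

theorem radialExt_coe {F : Type*} [Zero F] (X : S2 → F) (x : S2) : radialExt X (x : E3) = X x := by
  rw [radialExt_of_ne X x.ne_zero, dirPoint_coe]

theorem coe_dirPoint (y : E3) (hy : y ≠ 0) : (dirPoint y hy : E3) = ‖y‖⁻¹ • y := rfl

theorem dirPoint_smul {t : ℝ} (ht : 0 < t) {y : E3} (hy : y ≠ 0) (hty : t • y ≠ 0) :
    dirPoint (t • y) hty = dirPoint y hy := by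
  ext1
  rw [coe_dirPoint, coe_dirPoint, norm_smul, Real.norm_of_nonneg ht.le, smul_smul]
  congr 1
  field_simp

theorem homogOff_radialExt (X : S2 → F) : HomogOff 0 (radialExt X) := by
  intro t ht y hy
  have hty : t • y ≠ 0 := smul_ne_zero ht.ne' hy
  rw [radialExt_of_ne X hy, radialExt_of_ne X hty, dirPoint_smul ht hy]
  simp

/-- A homogeneous map is determined by its values on the sphere. -/
theorem HomogOff.eq_norm_smul {V : E3 → F} {k : ℤ} (hk : HomogOff k V) {y : E3} (hy : y ≠ 0) :
    V y = ‖y‖ ^ k • radialExt (fun x : S2 => V x) y := by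
  have hn : 0 < ‖y‖ := norm_pos_iff.mpr hy
  rw [radialExt_of_ne _ hy, ← hk _ hn _ (dirPoint y hy).ne_zero, coe_dirPoint, smul_smul,
    mul_inv_cancel₀ hn.ne', one_smul]

/-- The direction map is smooth from the open submanifold of nonzero vectors to the sphere. With
`SmoothOff.contMDiff` this translates between manifold smoothness and ordinary smoothness in space.
-/
theorem smoothOff_radialExt {X : S2 → F} (hX : ContMDiff (𝓡 2) 𝓘(ℝ, F) ∞ X) :
    SmoothOff (radialExt X) := by
  intro y hy
  let U : TopologicalSpace.Opens E3 := ⟨{z | z ≠ 0}, isOpen_ne⟩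
  have hn : ContMDiff 𝓘(ℝ, E3) 𝓘(ℝ, E3) ∞ (fun z : U => ‖(z : E3)‖⁻¹ • (z : E3)) := by
    intro z
    have hz : (z : E3) ≠ 0 := z.2
    refine (contMDiffAt_subtype_iff (f := fun z : E3 => ‖z‖⁻¹ • z)).2 (ContDiffAt.contMDiffAt ?_)
    exact ((contDiffAt_norm ℝ hz).inv (norm_ne_zero_iff.mpr hz)).smul contDiffAt_id
  have : Fact (Module.finrank ℝ E3 = 2 + 1) := ⟨by simp⟩
  have hd : ContMDiff 𝓘(ℝ, E3) (𝓡 2) ∞ (fun z : U => dirPoint (z : E3) z.2) :=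
    hn.codRestrict_sphere (n := 2) (fun z => (dirPoint (z : E3) z.2).2)
  have hc : ContMDiff 𝓘(ℝ, E3) 𝓘(ℝ, F) ∞ (fun z : U => radialExt X (z : E3)) := by
    refine (hX.comp hd).congr fun z => ?_
    simp [radialExt_of_ne X (y := (z : E3)) z.2]
  exact ((contMDiffAt_subtype_iff (U := U) (x := ⟨y, hy⟩)).1 (hc ⟨y, hy⟩)).contDiffAt

theorem SmoothOff.contMDiff {V : E3 → F} (hV : SmoothOff V) :
    ContMDiff (𝓡 2) 𝓘(ℝ, F) ∞ (fun x : S2 => V x) := fun x =>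
  haveI : Fact (Module.finrank ℝ E3 = 2 + 1) := ⟨by simp⟩
  (hV x x.ne_zero).contMDiffAt.comp x (contMDiff_coe_sphere x)

theorem SmoothOff.radialExt {V : E3 → F} (hV : SmoothOff V) :
    SmoothOff (radialExt fun x : S2 => V x) := smoothOff_radialExt hV.contMDiff

theorem SmoothOff.continuous {V : E3 → F} (hV : SmoothOff V) :
    Continuous (fun x : S2 => V x) := hV.contMDiff.continuous

/-! ### Contractions and divergences in Euclidean space. -/

theorem inner_stdVec (i j : Fin 3) : ⟪stdVec i, stdVec j⟫_ℝ = if i = j then 1 else 0 := by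
  simpa [stdVec] using orthonormal_iff_ite.mp (EuclideanSpace.basisFun (Fin 3) ℝ).orthonormal i j

theorem sum_inner_smul_stdVec (v : E3) : ∑ i, ⟪stdVec i, v⟫_ℝ • stdVec i = v := by
  simpa [stdVec] using (EuclideanSpace.basisFun (Fin 3) ℝ).sum_repr' v

theorem sum_inner_smul_map (A : E3 →L[ℝ] F) (v : E3) :
    ∑ i, ⟪stdVec i, v⟫_ℝ • A (stdVec i) = A v := by
  conv_rhs => rw [← sum_inner_smul_stdVec v]
  simp

theorem sum_inner_mul_inner (u v : E3) : ∑ i, ⟪u, stdVec i⟫_ℝ * ⟪stdVec i, v⟫_ℝ = ⟪u, v⟫_ℝ := by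
  simpa [stdVec] using (EuclideanSpace.basisFun (Fin 3) ℝ).sum_inner_mul_inner u v

/-- The tensor `∑ eᵢ ⊗ eᵢ` is fixed by `L⁻¹ ⊗ L*`. This is the invariance of the trace, in the form
that makes both divergences commute with `L`. -/
theorem sum_contraction_comp (β : E3 →L[ℝ] E3 →L[ℝ] F) (L : E3 ≃L[ℝ] E3) :
    ∑ i, β (L.symm (stdVec i)) (ContinuousLinearMap.adjoint (L : E3 →L[ℝ] E3) (stdVec i)) =
      ∑ i, β (stdVec i) (stdVec i) := by
  have h1 : ∀ i, β (L.symm (stdVec i)) (ContinuousLinearMap.adjoint (L : E3 →L[ℝ] E3) (stdVec i)) =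
      ∑ k, ⟪stdVec i, L (stdVec k)⟫_ℝ • β (L.symm (stdVec i)) (stdVec k) := by
    intro i
    rw [← sum_inner_smul_map (β (L.symm (stdVec i)))]
    refine Finset.sum_congr rfl fun k _ => ?_
    rw [ContinuousLinearMap.adjoint_inner_right, real_inner_comm]
    rfl
  simp_rw [h1]
  rw [Finset.sum_comm]
  refine Finset.sum_congr rfl fun k _ => ?_
  have h2 := sum_inner_smul_map ((β.flip (stdVec k)).comp (L.symm : E3 →L[ℝ] E3)) (L (stdVec k))
  simpa using h2

/-- Divergence of a vector field on Euclidean space. -/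
def ediv (V : E3 → E3) (y : E3) : ℝ := ∑ i, ⟪fderiv ℝ V y (stdVec i), stdVec i⟫_ℝ

/-- Divergence, in the first index, of a 2-tensor field on Euclidean space. -/
def tdiv (M : E3 → E3 →L[ℝ] E3) (y : E3) : E3 := ∑ i, fderiv ℝ M y (stdVec i) (stdVec i)

theorem ediv_congr {V W : E3 → E3} (h : ∀ y, y ≠ 0 → V y = W y) {y : E3} (hy : y ≠ 0) :
    ediv V y = ediv W y := by
  simp only [ediv, fderiv_congr_off h hy]

theorem tdiv_congr {V W : E3 → E3 →L[ℝ] E3} (h : ∀ y, y ≠ 0 → V y = W y) {y : E3} (hy : y ≠ 0) :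
    tdiv V y = tdiv W y := by
  simp only [tdiv, fderiv_congr_off h hy]

theorem SmoothOff.ediv {V : E3 → E3} (hV : SmoothOff V) : SmoothOff (ediv V) := fun y hy => by
  unfold SphereSobolev.ediv
  exact ContDiffAt.sum fun i _ => ((hV.fderiv y hy).clm_apply contDiffAt_const).inner ℝ
    contDiffAt_const

theorem SmoothOff.tdiv {V : E3 → E3 →L[ℝ] E3} (hV : SmoothOff V) : SmoothOff (tdiv V) :=
  fun y hy => by
  unfold SphereSobolev.tdiv
  exact ContDiffAt.sum fun i _ => ((hV.fderiv y hy).clm_apply contDiffAt_const).clm_apply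
    contDiffAt_const

theorem HomogOff.ediv {V : E3 → E3} {k : ℤ} (hk : HomogOff k V) (hV : SmoothOff V) :
    HomogOff (k - 1) (ediv V) := by
  intro t ht y hy
  simp [SphereSobolev.ediv, hk.fderiv hV t ht y hy, inner_smul_left, Finset.mul_sum]

theorem HomogOff.tdiv {V : E3 → E3 →L[ℝ] E3} {k : ℤ} (hk : HomogOff k V) (hV : SmoothOff V) :
    HomogOff (k - 1) (tdiv V) := by
  intro t ht y hy
  simp [SphereSobolev.tdiv, hk.fderiv hV t ht y hy, Finset.smul_sum]

theorem ediv_add {V W : E3 → E3} {y : E3} (hV : DifferentiableAt ℝ V y)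
    (hW : DifferentiableAt ℝ W y) : ediv (fun z => V z + W z) y = ediv V y + ediv W y := by
  simp [ediv, fderiv_fun_add hV hW, inner_add_left, Finset.sum_add_distrib]

theorem tdiv_add {V W : E3 → E3 →L[ℝ] E3} {y : E3} (hV : DifferentiableAt ℝ V y)
    (hW : DifferentiableAt ℝ W y) : tdiv (fun z => V z + W z) y = tdiv V y + tdiv W y := by
  simp [tdiv, fderiv_fun_add hV hW, Finset.sum_add_distrib]

theorem ediv_smul {a : E3 → ℝ} {V : E3 → E3} {y : E3} (ha : DifferentiableAt ℝ a y)
    (hV : DifferentiableAt ℝ V y) :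
    ediv (fun z => a z • V z) y = a y * ediv V y + fderiv ℝ a y (V y) := by
  simp only [ediv, fderiv_fun_smul ha hV, add_apply, smul_apply,
    ContinuousLinearMap.smulRight_apply, inner_add_left, inner_smul_left, Finset.sum_add_distrib,
    Finset.mul_sum]
  congr 1
  rw [← sum_inner_smul_map (fderiv ℝ a y)]
  refine Finset.sum_congr rfl fun i _ => ?_
  simp [real_inner_comm, mul_comm]

theorem ediv_smul_id {a : E3 → ℝ} {y : E3} (ha : DifferentiableAt ℝ a y) :
    ediv (fun z => a z • z) y = 3 * a y + fderiv ℝ a y y := by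
  have h := ediv_smul ha (differentiableAt_id (x := y))
  have h3 : ediv id y = 3 := by
    simp only [ediv, fderiv_id, ContinuousLinearMap.coe_id', id, inner_stdVec]
    simp
  simp only [id] at h
  rw [h, h3, mul_comm]

/-- A radial field of degree `-2` has no divergence. -/
theorem ediv_smul_id_of_homog {a : E3 → ℝ} {y : E3} (hy : y ≠ 0) (ha : DifferentiableAt ℝ a y)
    (hh : HomogOff (-3) a) : ediv (fun z => a z • z) y = 0 := by
  rw [ediv_smul_id ha, hh.fderiv_apply_self hy ha]
  simp

/-- The gradient of the weight is radial, so the extra term is a multiple of `M y y`. It vanishes on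
the sphere for tangent tensors, whose degree can therefore be changed freely. -/
theorem tdiv_norm_zpow_smul {M : E3 → E3 →L[ℝ] E3} {y : E3} (k : ℤ) (hy : y ≠ 0)
    (hM : DifferentiableAt ℝ M y) :
    tdiv (fun z => ‖z‖ ^ k • M z) y = ‖y‖ ^ k • tdiv M y + (k * ‖y‖ ^ (k - 2)) • M y y := by
  have ha := (smoothOff_norm_zpow k).differentiableAt hy
  simp only [tdiv, fderiv_fun_smul ha hM, add_apply, smul_apply,
    ContinuousLinearMap.smulRight_apply, Finset.sum_add_distrib, Finset.smul_sum]
  congr 1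
  rw [← sum_inner_smul_map (M y), Finset.smul_sum]
  refine Finset.sum_congr rfl fun i _ => ?_
  rw [fderiv_norm_zpow_apply k hy, smul_smul, real_inner_comm]

/-- The divergence commutes with linear changes of variables. -/
theorem ediv_map (L : E3 ≃L[ℝ] E3) {V : E3 → E3} {y : E3} (hV : DifferentiableAt ℝ V (L.symm y)) :
    ediv (fun z => L (V (L.symm z))) y = ediv V (L.symm y) := by
  have h : fderiv ℝ (fun z => L (V (L.symm z))) y =
      (L : E3 →L[ℝ] E3) ∘L fderiv ℝ V (L.symm y) ∘L (L.symm : E3 →L[ℝ] E3) :=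
    ((L.hasFDerivAt (x := V (L.symm y))).comp y
      (hV.hasFDerivAt.comp y (L.symm.hasFDerivAt (x := y)))).fderiv
  have h2 := sum_contraction_comp ((innerSL ℝ).comp (fderiv ℝ V (L.symm y))) L
  simp only [ContinuousLinearMap.comp_apply, innerSL_apply_apply,
    ContinuousLinearMap.adjoint_inner_right] at h2
  simpa [ediv, h] using h2

theorem tdiv_map (L : E3 ≃L[ℝ] E3) {M : E3 → E3 →L[ℝ] E3} {y : E3}
    (hM : DifferentiableAt ℝ M (L.symm y)) :
    tdiv (fun z => (L : E3 →L[ℝ] E3) ∘L M (L.symm z) ∘L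
      ContinuousLinearMap.adjoint (L : E3 →L[ℝ] E3)) y = L (tdiv M (L.symm y)) := by
  have h0 : HasFDerivAt (fun z => M (L.symm z)) (fderiv ℝ M (L.symm y) ∘L (L.symm : E3 →L[ℝ] E3)) y :=
    hM.hasFDerivAt.comp y (L.symm.hasFDerivAt (x := y))
  have h := (((hasFDerivAt_const (L : E3 →L[ℝ] E3) y).clm_comp
    (h0.clm_comp (hasFDerivAt_const (ContinuousLinearMap.adjoint (L : E3 →L[ℝ] E3)) y)))).fderiv
  have h2 := sum_contraction_comp (fderiv ℝ M (L.symm y)) L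
  simp only [tdiv, ← h2, h, map_sum]
  refine Finset.sum_congr rfl fun i _ => ?_
  simp

/-! ### Spherical divergences as Euclidean ones. -/

/-- The orthogonal projection along a unit vector `y`, as a polynomial in `y`. -/
def projAlong (y : E3) : E3 →L[ℝ] E3 :=
  ContinuousLinearMap.id ℝ E3 - (innerSL ℝ y).smulRight y

theorem tangentProj_apply (x : S2) (v : E3) : tangentProj x v = v - ⟪(x : E3), v⟫_ℝ • (x : E3) := by
  simp [tangentProj]

theorem tangentProj_self (x : S2) : tangentProj x (x : E3) = 0 := by
  simp [tangentProj_apply]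

theorem inner_tangentProj_left (x : S2) (u v : E3) :
    ⟪tangentProj x u, v⟫_ℝ = ⟪u, tangentProj x v⟫_ℝ := by
  simp [tangentProj_apply, inner_sub_left, inner_sub_right, inner_smul_left, inner_smul_right,
    real_inner_comm]
  ring

theorem inner_tangentProj_self (x : S2) (u : E3) : ⟪tangentProj x u, (x : E3)⟫_ℝ = 0 := by
  rw [inner_tangentProj_left, tangentProj_self, inner_zero_right]

theorem tangentProj_of_inner_eq_zero (x : S2) {u : E3} (h : ⟪u, (x : E3)⟫_ℝ = 0) :
    tangentProj x u = u := by
  rw [tangentProj_apply, real_inner_comm, h, zero_smul, sub_zero]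

theorem tangentProj_idem (x : S2) (u : E3) : tangentProj x (tangentProj x u) = tangentProj x u :=
  tangentProj_of_inner_eq_zero x (inner_tangentProj_self x u)

theorem contDiff_projAlong : ContDiff ℝ ∞ projAlong := by
  have h : ContDiff ℝ ∞ fun y : E3 => innerSL ℝ y := (innerSL ℝ).contDiff
  exact contDiff_const.sub (h.smulRight contDiff_id)

theorem fderiv_radialExt_tangentProj {X : S2 → F} (x : S2)
    (hX : DifferentiableAt ℝ (radialExt X) (x : E3)) (u : E3) :
    fderiv ℝ (radialExt X) (x : E3) (tangentProj x u) = fderiv ℝ (radialExt X) (x : E3) u := by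
  rw [tangentProj_apply, map_sub, map_smul, (homogOff_radialExt X).fderiv_apply_self x.ne_zero hX]
  simp

/-- The extension is constant on rays, so the normal direction contributes nothing and the
tangential trace equals the full trace. -/
theorem divField_eq_ediv {X : S2 → E3} (x : S2)
    (hX : DifferentiableAt ℝ (radialExt X) (x : E3)) :
    divField X x = ediv (radialExt X) (x : E3) := by
  have h0 := (homogOff_radialExt X).fderiv_apply_self_eq_zero x.ne_zero hX
  have h1 := sum_inner_smul_map ((innerSL ℝ (x : E3)).comp (fderiv ℝ (radialExt X) (x : E3))) (x : E3)
  simp only [ContinuousLinearMap.comp_apply, innerSL_apply_apply, h0, inner_zero_right,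
    smul_eq_mul] at h1
  simp only [divField, covDeriv, ediv, inner_tangentProj_left, tangentProj_idem,
    fderiv_radialExt_tangentProj x hX]
  simp only [tangentProj_apply, inner_sub_right, inner_smul_right, Finset.sum_sub_distrib]
  rw [sub_eq_self, ← h1]
  refine Finset.sum_congr rfl fun i _ => ?_
  rw [real_inner_comm (x : E3) (stdVec i), real_inner_comm (x : E3)]

theorem divTensor_eq_tdiv {T : S2 → E3 →L[ℝ] E3} (x : S2)
    (hT : DifferentiableAt ℝ (radialExt T) (x : E3)) :
    divTensor T x = tangentProj x (tdiv (radialExt T) (x : E3)) := by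
  have h0 := (homogOff_radialExt T).fderiv_apply_self_eq_zero x.ne_zero hT
  have h1 := sum_inner_smul_map ((fderiv ℝ (radialExt T) (x : E3)).flip (x : E3)) (x : E3)
  simp only [ContinuousLinearMap.flip_apply, h0, zero_apply] at h1
  simp only [divTensor, covDerivTensor, ContinuousLinearMap.comp_apply, tangentProj_idem,
    fderiv_radialExt_tangentProj x hT, tdiv, ← map_sum]
  congr 1
  simp only [tangentProj_apply, map_sub, map_smul, Finset.sum_sub_distrib]
  rw [sub_eq_self]
  refine (Finset.sum_congr rfl fun i _ => ?_).trans h1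
  rw [real_inner_comm (x : E3) (stdVec i)]

/-- The divergence on the sphere of the tangential part of a field which is homogeneous of degree
`-2` is its divergence in space. -/
theorem divField_tangentProj {V : E3 → E3} (hV : SmoothOff V) (hh : HomogOff (-2) V) (x : S2) :
    divField (fun z => tangentProj z (V z)) x = ediv V x := by
  have hP : SmoothOff (fun z => projAlong z (V z)) := fun y hy =>
    contDiff_projAlong.contDiffAt.clm_apply (hV y hy)
  have hX : SmoothOff (radialExt fun z : S2 => tangentProj z (V z)) := hP.radialExt
  have ha : SmoothOff (fun z : E3 => ‖z‖ ^ (-2 : ℤ) * ⟪z, V z⟫_ℝ) := fun y hy =>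
    (smoothOff_norm_zpow _ y hy).mul (contDiffAt_id.inner ℝ (hV y hy))
  have hah : HomogOff (-3) (fun z : E3 => ‖z‖ ^ (-2 : ℤ) * ⟪z, V z⟫_ℝ) := by
    intro t ht y hy
    have h1 := homogOff_norm_zpow (-2) t ht y hy
    simp only at h1 ⊢
    rw [h1, hh t ht y hy, inner_smul_left, inner_smul_right]
    simp only [smul_eq_mul, RCLike.conj_to_real]
    have : t ^ (-3 : ℤ) = t ^ (-2 : ℤ) * (t * t ^ (-2 : ℤ)) := by
      rw [← zpow_one_add₀ ht.ne', ← zpow_add₀ ht.ne']; norm_num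
    rw [this]; ring
  -- Tangential plus radial part. The radial part is divergence free by its degree, and the
  -- derivative of the weight pairs a radial gradient with a tangent vector.
  have hdec : ∀ y : E3, y ≠ 0 → V y = ‖y‖ ^ (-2 : ℤ) • radialExt (fun z : S2 => tangentProj z (V z)) y
      + (‖y‖ ^ (-2 : ℤ) * ⟪y, V y⟫_ℝ) • y := by
    intro y hy
    have hn : ‖y‖ ≠ 0 := norm_ne_zero_iff.mpr hy
    have h1 := hh.eq_norm_smul hy
    rw [radialExt_of_ne _ hy] at h1 ⊢
    rw [tangentProj_apply, smul_sub, ← h1, coe_dirPoint, inner_smul_left]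
    have h2 : V (‖y‖⁻¹ • y) = ‖y‖ ^ 2 • V y := by
      rw [hh _ (by positivity) y hy]
      simp
    rw [h2, inner_smul_right, smul_smul, smul_smul]
    rw [sub_add, eq_comm, sub_eq_self, sub_eq_zero]
    congr 1
    simp
    field_simp
  rw [divField_eq_ediv x (hX.differentiableAt x.ne_zero), ediv_congr hdec x.ne_zero,
    ediv_add, ediv_smul_id_of_homog x.ne_zero (ha.differentiableAt x.ne_zero) hah, ediv_smul,
    fderiv_norm_zpow_apply _ x.ne_zero, radialExt_coe, real_inner_comm, inner_tangentProj_self]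
  · simp
  · exact (smoothOff_norm_zpow _).differentiableAt x.ne_zero
  · exact hX.differentiableAt x.ne_zero
  · exact ((smoothOff_norm_zpow _).differentiableAt x.ne_zero).smul (hX.differentiableAt x.ne_zero)
  · exact (ha.differentiableAt x.ne_zero).smul differentiableAt_id

theorem contDiff_adjoint_clm : ContDiff ℝ ∞ fun A : E3 →L[ℝ] E3 => adjoint A := by
  let Φ : (E3 →L[ℝ] E3) →ₗ[ℝ] (E3 →L[ℝ] E3) :=
    { toFun := fun A => adjoint A
      map_add' := fun A B => map_add _ A B
      map_smul' := fun c A => by simp }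
  exact (LinearMap.toContinuousLinearMap Φ).contDiff

theorem smoothOff_adjoint {M : E3 → E3 →L[ℝ] E3} (hM : SmoothOff M) :
    SmoothOff fun y => adjoint (M y) := fun y hy =>
  (contDiff_adjoint_clm.contDiffAt (x := M y)).comp y (hM y hy)

theorem fderiv_apply_apply {M : E3 → E3 →L[ℝ] E3} {y : E3} (hM : DifferentiableAt ℝ M y)
    (u w : E3) : fderiv ℝ M y u w = fderiv ℝ (fun z => M z w) y u := by
  rw [(hM.hasFDerivAt.clm_apply (hasFDerivAt_const w y)).fderiv]
  simp

theorem smoothOff_inner_smulRight {V W : E3 → E3} (hV : SmoothOff V) (hW : SmoothOff W) :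
    SmoothOff fun y => (innerSL ℝ (W y)).smulRight (V y) := fun y hy =>
  (((innerSL ℝ).contDiff.contDiffAt (x := W y)).comp y (hW y hy)).smulRight (hV y hy)

theorem smoothOff_id : SmoothOff fun y : E3 => y := fun _ _ => contDiffAt_id

/-- The product rule gives `3 V` from the trace of the identity and `-2 V` from Euler's identity. -/
theorem tdiv_inner_smulRight {V : E3 → E3} {y : E3} (hy : y ≠ 0) (hV : SmoothOff V)
    (hh : HomogOff (-2) V) : tdiv (fun z => (innerSL ℝ z).smulRight (V z)) y = V y := by
  have hd := hV.differentiableAt hy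
  have h : ∀ u w, fderiv ℝ (fun z => (innerSL ℝ z).smulRight (V z)) y u w =
      ⟪y, w⟫_ℝ • fderiv ℝ V y u + ⟪u, w⟫_ℝ • V y := by
    intro u w
    rw [fderiv_apply_apply ((smoothOff_inner_smulRight hV smoothOff_id).differentiableAt hy)]
    simp only [ContinuousLinearMap.smulRight_apply, innerSL_apply_apply]
    rw [fderiv_fun_smul (differentiableAt_fun_id.inner ℝ (differentiableAt_const w)) hd]
    simp only [add_apply, smul_apply, ContinuousLinearMap.smulRight_apply]
    rw [fderiv_inner_apply ℝ differentiableAt_fun_id (differentiableAt_const w)]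
    simp
  have h2 := sum_inner_smul_map (fderiv ℝ V y) y
  simp only [tdiv, h, inner_stdVec, if_true, one_smul, Finset.sum_add_distrib]
  simp_rw [fun i => real_inner_comm (stdVec i) y]
  rw [h2, hh.fderiv_apply_self hy hd]
  simp
  module

/-- When `W` has degree -2, the radial term has a coefficient of degree -3 and disappears under a
second divergence. -/
theorem tdiv_inner_smulRight_id {W : E3 → E3} {y : E3} (hy : y ≠ 0) (hW : SmoothOff W) :
    tdiv (fun z => (innerSL ℝ (W z)).smulRight z) y = ediv W y • y + W y := by
  have hd := hW.differentiableAt hy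
  have h : ∀ u w, fderiv ℝ (fun z => (innerSL ℝ (W z)).smulRight z) y u w =
      ⟪W y, w⟫_ℝ • u + ⟪fderiv ℝ W y u, w⟫_ℝ • y := by
    intro u w
    rw [fderiv_apply_apply ((smoothOff_inner_smulRight smoothOff_id hW).differentiableAt hy)]
    simp only [ContinuousLinearMap.smulRight_apply, innerSL_apply_apply]
    rw [fderiv_fun_smul (hd.inner ℝ (differentiableAt_const w)) differentiableAt_fun_id]
    simp only [add_apply, smul_apply, ContinuousLinearMap.smulRight_apply]
    rw [fderiv_inner_apply ℝ hd (differentiableAt_const w)]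
    simp
  have h2 := sum_inner_smul_stdVec (W y)
  simp only [tdiv, h, Finset.sum_add_distrib, ediv, Finset.sum_smul]
  rw [add_comm]
  congr 1
  simpa only [real_inner_comm] using h2

/-- The tangential part of an endomorphism. -/
def tangentPart (x : S2) (A : E3 →L[ℝ] E3) : E3 →L[ℝ] E3 := tangentProj x ∘L A ∘L tangentProj x

theorem smoothOff_projAlong_comp {M : E3 → E3 →L[ℝ] E3} (hM : SmoothOff M) :
    SmoothOff fun y => projAlong y ∘L M y ∘L projAlong y := fun y hy =>
  contDiff_projAlong.contDiffAt.clm_comp ((hM y hy).clm_comp contDiff_projAlong.contDiffAt)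

/-- The double divergence on the sphere of a tangent tensor, as a double divergence in space. -/
theorem divField_divTensor {T : S2 → E3 →L[ℝ] E3} (hT : SmoothOff (radialExt T))
    (htan : IsTangentTensor T) (x : S2) :
    divField (divTensor T) x =
      ediv (tdiv fun y => ‖y‖ ^ (-1 : ℤ) • radialExt T y) x := by
  have hS : SmoothOff fun y => ‖y‖ ^ (-1 : ℤ) • radialExt T y := fun y hy =>
    (smoothOff_norm_zpow _ y hy).smul (hT y hy)
  have hH : HomogOff (-1) fun y => ‖y‖ ^ (-1 : ℤ) • radialExt T y := by
    intro t ht y hy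
    have h1 := homogOff_norm_zpow (-1) t ht y hy
    have h2 := homogOff_radialExt T t ht y hy
    simp only at h1 ⊢
    rw [h1, h2, zpow_zero, one_smul, smul_smul, smul_eq_mul]
  rw [← divField_tangentProj hS.tdiv (hH.tdiv hS) x]
  congr 1
  funext z
  rw [divTensor_eq_tdiv z (hT.differentiableAt z.ne_zero),
    tdiv_norm_zpow_smul _ z.ne_zero (hT.differentiableAt z.ne_zero), radialExt_coe, (htan z).1]
  simp

theorem isTangentTensor_tangentPart (A : S2 → E3 →L[ℝ] E3) :
    IsTangentTensor fun x => tangentPart x (A x) := fun x => by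
  simp [tangentPart, tangentProj_self, inner_tangentProj_self]

/-- The double divergence in space of a tensor field which is homogeneous of degree `-1`, in terms
of its tangential part on the sphere and of a vector field that collects its normal components. -/
theorem ediv_tdiv_eq {M : E3 → E3 →L[ℝ] E3} (hM : SmoothOff M) (hh : HomogOff (-1) M) (x : S2) :
    ediv (tdiv M) x = divField (divTensor fun z => tangentPart z (M z)) x +
      divField (fun z => tangentProj z (M z z + adjoint (M z) z)) x := by
  set T : S2 → E3 →L[ℝ] E3 := fun z => tangentPart z (M z) with hTdef
  set V : E3 → E3 := fun y => ‖y‖ ^ (-2 : ℤ) • M y y with hVdef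
  -- `V` already contains the doubly normal component of `M`; the subtraction in `W` keeps it from
  -- being counted twice.
  set W : E3 → E3 := fun y => ‖y‖ ^ (-2 : ℤ) • adjoint (M y) y -
    (‖y‖ ^ (-4 : ℤ) * ⟪M y y, y⟫_ℝ) • y with hWdef
  have hT : SmoothOff (radialExt T) := (smoothOff_projAlong_comp hM).radialExt
  have hMy : SmoothOff fun y => M y y := fun y hy => (hM y hy).clm_apply contDiffAt_id
  have hMa : SmoothOff fun y => adjoint (M y) y := fun y hy =>
    (smoothOff_adjoint hM y hy).clm_apply contDiffAt_id
  have hV : SmoothOff V := fun y hy => (smoothOff_norm_zpow _ y hy).smul (hMy y hy)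
  have hW : SmoothOff W := fun y hy =>
    ((smoothOff_norm_zpow _ y hy).smul (hMa y hy)).sub
      (((smoothOff_norm_zpow _ y hy).mul ((hMy y hy).inner ℝ contDiffAt_id)).smul contDiffAt_id)
  have hpow : ∀ t : ℝ, 0 < t → t ^ (-1 : ℤ) = t⁻¹ ∧ t ^ (-2 : ℤ) = t⁻¹ ^ 2 ∧ t ^ (-4 : ℤ) = t⁻¹ ^ 4 := by
    intro t _
    refine ⟨by simp, ?_, ?_⟩ <;> rw [inv_pow, zpow_neg] <;> norm_cast
  have hVh : HomogOff (-2) V := by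
    intro t ht y hy
    simp only [hVdef, hh t ht y hy, norm_smul, Real.norm_of_nonneg ht.le, mul_zpow, smul_apply,
      map_smul, smul_smul]
    congr 1
    rw [(hpow t ht).1]; field_simp
  have hWh : HomogOff (-2) W := by
    intro t ht y hy
    simp only [hWdef, hh t ht y hy, norm_smul, Real.norm_of_nonneg ht.le, mul_zpow, smul_apply,
      map_smul, smul_smul, smul_sub, RCLike.conj_to_real, inner_smul_left,
      inner_smul_right]
    congr 2
    · rw [(hpow t ht).1]; field_simp
    · rw [(hpow t ht).1, (hpow t ht).2.1, (hpow t ht).2.2]; field_simp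
  have hS : SmoothOff fun y => ‖y‖ ^ (-1 : ℤ) • radialExt T y := fun y hy =>
    (smoothOff_norm_zpow _ y hy).smul (hT y hy)
  have hSV : SmoothOff fun y => (innerSL ℝ y).smulRight (V y) :=
    smoothOff_inner_smulRight hV smoothOff_id
  have hSW : SmoothOff fun y => (innerSL ℝ (W y)).smulRight y :=
    smoothOff_inner_smulRight smoothOff_id hW
  have hdec : ∀ y : E3, y ≠ 0 → M y = ‖y‖ ^ (-1 : ℤ) • radialExt T y +
      ((innerSL ℝ y).smulRight (V y) + (innerSL ℝ (W y)).smulRight y) := by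
    intro y hy
    have hn : ‖y‖ ≠ 0 := norm_ne_zero_iff.mpr hy
    have hn0 : 0 < ‖y‖ := norm_pos_iff.mpr hy
    have h1 : M (‖y‖⁻¹ • y) = ‖y‖ • M y := by
      rw [hh _ (by positivity) y hy]
      simp
    ext1 u
    rw [radialExt_of_ne _ hy, hTdef]
    simp only [tangentPart, tangentProj_apply, ContinuousLinearMap.comp_apply, coe_dirPoint,
      add_apply, smul_apply, ContinuousLinearMap.smulRight_apply, innerSL_apply_apply, h1, hVdef,
      hWdef, inner_sub_left, inner_smul_left, ContinuousLinearMap.adjoint_inner_left,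
      RCLike.conj_to_real, (hpow _ hn0).1, (hpow _ hn0).2.1, (hpow _ hn0).2.2]
    simp only [map_sub, map_smul, inner_sub_right, inner_smul_right, real_inner_comm y]
    match_scalars <;> field_simp <;> ring
  have hdiv : ∀ y : E3, y ≠ 0 → tdiv M y = tdiv (fun y => ‖y‖ ^ (-1 : ℤ) • radialExt T y) y +
      ((V y + W y) + ediv W y • y) := by
    intro y hy
    rw [tdiv_congr hdec hy, tdiv_add (hS.differentiableAt hy)
      ((hSV.differentiableAt hy).fun_add (hSW.differentiableAt hy)),
      tdiv_add (hSV.differentiableAt hy) (hSW.differentiableAt hy), tdiv_inner_smulRight hy hV hVh,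
      tdiv_inner_smulRight_id hy hW]
    abel
  have hx := x.ne_zero
  have hVW : SmoothOff fun y => V y + W y := fun y hy => (hV y hy).add (hW y hy)
  have hVWh : HomogOff (-2) fun y => V y + W y := fun t ht y hy => by
    simp only [hVh t ht y hy, hWh t ht y hy, smul_add]
  have hWd := hW.ediv.differentiableAt hx
  rw [ediv_congr hdiv hx, ediv_add (hS.tdiv.differentiableAt hx)
    ((hVW.differentiableAt hx).fun_add (hWd.fun_smul differentiableAt_fun_id)),
    ediv_add (hVW.differentiableAt hx) (hWd.fun_smul differentiableAt_fun_id),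
    ediv_smul_id_of_homog hx hWd (hWh.ediv hW), add_zero, ← divField_tangentProj hVW hVWh,
    ← divField_divTensor hT (isTangentTensor_tangentPart _)]
  congr 2
  funext z
  simp [hVdef, hWdef, tangentProj_self]

/-! ### The induced sphere map and its Jacobian. -/

/-- The map of the sphere induced by a linear automorphism of space. -/
def sphereMap (L : E3 ≃L[ℝ] E3) (x : S2) : S2 :=
  dirPoint (L x) ((map_ne_zero_iff L L.injective).2 x.ne_zero)

theorem coe_sphereMap (L : E3 ≃L[ℝ] E3) (x : S2) : (sphereMap L x : E3) = ‖L x‖⁻¹ • L x := rfl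

theorem norm_map_pos (L : E3 ≃L[ℝ] E3) (x : S2) : 0 < ‖L x‖ :=
  norm_pos_iff.mpr ((map_ne_zero_iff L L.injective).2 x.ne_zero)

theorem symm_coe_sphereMap (L : E3 ≃L[ℝ] E3) (x : S2) :
    L.symm (sphereMap L x : E3) = ‖L x‖⁻¹ • (x : E3) := by
  simp [coe_sphereMap]

theorem norm_symm_coe_sphereMap (L : E3 ≃L[ℝ] E3) (x : S2) :
    ‖L.symm (sphereMap L x : E3)‖ = ‖L x‖⁻¹ := by
  simp [symm_coe_sphereMap, norm_smul]

theorem sphereMap_dirPoint (L : E3 ≃L[ℝ] E3) {v : E3} (hv : v ≠ 0) (hLv : L v ≠ 0) :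
    sphereMap L (dirPoint v hv) = dirPoint (L v) hLv := by
  ext1
  have hn : ‖v‖ ≠ 0 := norm_ne_zero_iff.mpr hv
  simp only [coe_sphereMap, coe_dirPoint, map_smul, norm_smul, norm_inv, norm_norm, smul_smul]
  congr 1
  field_simp

theorem sphereMap_symm_sphereMap (L : E3 ≃L[ℝ] E3) (x : S2) :
    sphereMap L.symm (sphereMap L x) = x := by
  have h : L.symm (L (x : E3)) ≠ 0 := by simpa using x.ne_zero
  rw [sphereMap.eq_def L, sphereMap_dirPoint L.symm _ h]
  ext1
  simp [coe_dirPoint]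

theorem continuous_sphereMap (L : E3 ≃L[ℝ] E3) : Continuous (sphereMap L) := by
  refine Continuous.subtype_mk ?_ _
  have h : Continuous fun x : S2 => L (x : E3) := L.continuous.comp continuous_subtype_val
  exact (h.norm.inv₀ fun x => (norm_map_pos L x).ne').smul h

/-- The homeomorphism of the sphere induced by a linear automorphism of space. -/
def sphereHomeo (L : E3 ≃L[ℝ] E3) : S2 ≃ₜ S2 where
  toFun := sphereMap L
  invFun := sphereMap L.symm
  left_inv := sphereMap_symm_sphereMap L
  right_inv := sphereMap_symm_sphereMap L.symm
  continuous_toFun := continuous_sphereMap L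
  continuous_invFun := continuous_sphereMap L.symm

theorem measurableEmbedding_sphereMap (L : E3 ≃L[ℝ] E3) : MeasurableEmbedding (sphereMap L) :=
  (sphereHomeo L).measurableEmbedding

/-- The Jacobian of the inverse of `sphereMap L`, for `L` of determinant one. -/
def sphereJac (L : E3 ≃L[ℝ] E3) (y : S2) : ℝ≥0 := ‖L.symm y‖₊⁻¹ ^ 3

theorem coe_sphereJac (L : E3 ≃L[ℝ] E3) (y : S2) : (sphereJac L y : ℝ) = ‖L.symm y‖⁻¹ ^ 3 := by
  simp [sphereJac]

theorem continuous_sphereJac (L : E3 ≃L[ℝ] E3) : Continuous (sphereJac L) := by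
  have h : Continuous fun x : S2 => L.symm (x : E3) := L.symm.continuous.comp continuous_subtype_val
  exact (h.nnnorm.inv₀ fun x => by simpa using x.ne_zero).pow 3

theorem inv_norm_symm_le (L : E3 ≃L[ℝ] E3) (y : S2) :
    ‖L.symm y‖⁻¹ ≤ ‖(L : E3 →L[ℝ] E3)‖ := by
  have h := (L : E3 →L[ℝ] E3).le_opNorm (L.symm y)
  rw [inv_le_iff_one_le_mul₀ (norm_map_pos L.symm y)]
  simpa using h

theorem inv_norm_map_le (L : E3 ≃L[ℝ] E3) (x : S2) :
    ‖L x‖⁻¹ ≤ ‖(L.symm : E3 →L[ℝ] E3)‖ := by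
  simpa using inv_norm_symm_le L.symm x

theorem sphereJac_le (L : E3 ≃L[ℝ] E3) (y : S2) : sphereJac L y ≤ ‖(L : E3 →L[ℝ] E3)‖₊ ^ 3 := by
  rw [← NNReal.coe_le_coe, coe_sphereJac]
  push_cast
  exact pow_le_pow_left₀ (by positivity) (inv_norm_symm_le L y) 3

/-- `toSphere` measures a set by the volume of the cone over it. A point `r p` lies in the image of
the unit cone exactly when `p ∈ s` and `|L⁻¹(r p)| < 1`, which is a region under a radial graph. -/
theorem image_cone_sphereMap (L : E3 ≃L[ℝ] E3) (s : Set S2) :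
    L '' (Set.Ioo (0 : ℝ) 1 • ((↑) '' (sphereMap L ⁻¹' s))) = (↑) ''
      (homeomorphUnitSphereProd E3 ⁻¹' {p | p.1 ∈ s ∧ (p.2 : ℝ) < ‖L.symm p.1‖⁻¹}) := by
  ext w
  constructor
  · rintro ⟨_, ⟨t, ht, _, ⟨x, hx, rfl⟩, rfl⟩, rfl⟩
    have hne : (t • (x : E3)) ≠ 0 := smul_ne_zero ht.1.ne' x.ne_zero
    have hLne : L (t • (x : E3)) ≠ 0 := (map_ne_zero_iff L L.injective).2 hne
    refine ⟨⟨L (t • (x : E3)), hLne⟩, ?_, rfl⟩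
    have h1 : (homeomorphUnitSphereProd E3 ⟨L (t • (x : E3)), hLne⟩).1 = sphereMap L x := by
      have h : sphereMap L x = dirPoint (L (t • (x : E3))) hLne := by
        rw [← sphereMap_dirPoint L hne hLne, dirPoint_smul ht.1 x.ne_zero, dirPoint_coe]
      rw [h]
      ext1
      simp [coe_dirPoint]
    have h2 : ((homeomorphUnitSphereProd E3 ⟨L (t • (x : E3)), hLne⟩).2 : ℝ) = t * ‖L x‖ := by
      simp [norm_smul, abs_of_pos ht.1]
    simp only [Set.mem_preimage, Set.mem_ofPred_eq, h1, h2, norm_symm_coe_sphereMap, inv_inv]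
    exact ⟨hx, by nlinarith [norm_map_pos L x, ht.2]⟩
  · rintro ⟨⟨w, hw⟩, ⟨h1, h2⟩, rfl⟩
    have hw' : w ≠ 0 := hw
    have hn : 0 < ‖w‖ := norm_pos_iff.mpr hw'
    have hv : L.symm w ≠ 0 := (map_ne_zero_iff L.symm L.symm.injective).2 hw'
    have hd : (homeomorphUnitSphereProd E3 ⟨w, hw⟩).1 = dirPoint w hw' := by
      ext1
      simp [coe_dirPoint]
    have h3 : ((homeomorphUnitSphereProd E3 ⟨w, hw⟩).2 : ℝ) = ‖w‖ := by simp
    rw [hd, h3, coe_dirPoint] at h2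
    rw [hd] at h1
    refine ⟨L.symm w, ⟨‖L.symm w‖, ⟨norm_pos_iff.mpr hv, ?_⟩, _, ⟨dirPoint (L.symm w) hv, ?_, rfl⟩, ?_⟩,
      by simp⟩
    · rw [map_smul, norm_smul, norm_inv, norm_norm, mul_inv, inv_inv] at h2
      have hv' := norm_pos_iff.mpr hv
      field_simp at h2
      exact h2
    · have hLv : L (L.symm w) ≠ 0 := by simpa using hw'
      rw [Set.mem_preimage, sphereMap_dirPoint L hv hLv]
      simpa using h1
    · simp only [coe_dirPoint]
      rw [smul_smul, mul_inv_cancel₀ (norm_ne_zero_iff.mpr hv), one_smul]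

/-- Since the determinant is one, `L` preserves the volume of the cone. In polar coordinates the
image has volume `∫ R³/3` with `R = |L⁻¹y|⁻¹`, and the factor 3 in `toSphere` cancels the
denominator. -/
theorem map_sphereMap_area (L : E3 ≃L[ℝ] E3) (hL : LinearMap.det (L : E3 →ₗ[ℝ] E3) = 1) :
    area.map (sphereMap L) = area.withDensity fun y => (sphereJac L y : ℝ≥0∞) := by
  ext s hs
  have hs' : MeasurableSet (sphereMap L ⁻¹' s) := (continuous_sphereMap L).measurable hs
  have hJ := (continuous_sphereJac L).measurable
  set B : Set (S2 × Set.Ioi (0 : ℝ)) := {p | p.1 ∈ s ∧ (p.2 : ℝ) < ‖L.symm p.1‖⁻¹} with hB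
  have hBm : MeasurableSet B := by
    have hc : Measurable fun p : S2 × Set.Ioi (0 : ℝ) => ‖L.symm (p.1 : E3)‖⁻¹ :=
      ((L.symm.continuous.measurable.comp (measurable_subtype_coe.comp measurable_fst)).norm).inv
    exact (measurable_fst hs).inter
      (measurableSet_lt (measurable_subtype_coe.comp measurable_snd) hc)
  rw [Measure.map_apply (continuous_sphereMap L).measurable hs, withDensity_apply _ hs]
  conv_lhs => rw [area, Measure.toSphere_apply' _ hs']
  have h1 := Measure.addHaar_image_linearMap (volume : Measure E3) (L : E3 →ₗ[ℝ] E3)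
    (Set.Ioo (0 : ℝ) 1 • ((↑) '' (sphereMap L ⁻¹' s)))
  rw [hL, abs_one, ENNReal.ofReal_one, one_mul] at h1
  have h2 : (volume : Measure E3) (Set.Ioo (0 : ℝ) 1 • ((↑) '' (sphereMap L ⁻¹' s))) =
      ∫⁻ y in s, (3 : ℝ≥0∞)⁻¹ * sphereJac L y ∂area := by
    rw [← h1]
    have h3 := image_cone_sphereMap L s
    have h4 : ((L : E3 →ₗ[ℝ] E3) : E3 → E3) = L := rfl
    rw [h4, h3, ← (MeasurableEmbedding.subtype_coe (measurableSet_singleton (0 : E3)).compl).comap_apply,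
      (Measure.measurePreserving_homeomorphUnitSphereProd (volume : Measure E3)).measure_preimage
        hBm.nullMeasurableSet, Measure.prod_apply hBm, ← lintegral_indicator hs]
    refine lintegral_congr fun y => ?_
    by_cases hy : y ∈ s
    · have hpos : 0 < ‖L.symm (y : E3)‖⁻¹ := inv_pos.mpr (norm_map_pos L.symm y)
      have h5 : Prod.mk y ⁻¹' B = Set.Iio ⟨‖L.symm (y : E3)‖⁻¹, hpos⟩ := by
        ext r
        simp [hB, hy, ← Subtype.coe_lt_coe]
      rw [h5, Measure.volumeIoiPow_apply_Iio, Set.indicator_of_mem hy]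
      simp only [finrank_euclideanSpace_fin]
      norm_num
      rw [ENNReal.ofReal_div_of_pos (by norm_num), div_eq_mul_inv, mul_comm]
      congr 1
      · norm_num
      · rw [← inv_pow, ← coe_sphereJac, ENNReal.ofReal_coe_nnreal]
    · have h5 : Prod.mk y ⁻¹' B = ∅ := by
        ext r
        simp [hB, hy]
      simp [h5, hy]
  rw [h2, lintegral_const_mul _ (by fun_prop), ← mul_assoc]
  simp only [finrank_euclideanSpace_fin]
  rw [show ((3 : ℕ) : ℝ≥0∞) = 3 by norm_num, ENNReal.mul_inv_cancel (by norm_num) (by norm_num),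
    one_mul]

theorem map_sphereMap_area_le (L : E3 ≃L[ℝ] E3) (hL : LinearMap.det (L : E3 →ₗ[ℝ] E3) = 1) :
    area.map (sphereMap L) ≤ ((‖(L : E3 →L[ℝ] E3)‖₊ ^ 3 : ℝ≥0) : ℝ≥0∞) • area := by
  rw [map_sphereMap_area L hL, ← withDensity_const]
  exact withDensity_mono (ae_of_all _ fun y => ENNReal.coe_le_coe.2 (sphereJac_le L y))

theorem integral_comp_sphereMap (L : E3 ≃L[ℝ] E3) (hL : LinearMap.det (L : E3 →ₗ[ℝ] E3) = 1)
    (f : S2 → ℝ) : ∫ x, f (sphereMap L x) ∂area = ∫ y, sphereJac L y * f y ∂area := by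
  rw [← (measurableEmbedding_sphereMap L).integral_map, map_sphereMap_area L hL,
    integral_withDensity_eq_integral_smul (continuous_sphereJac L).measurable]
  rfl

theorem memLp_comp_sphereMap (L : E3 ≃L[ℝ] E3) (hL : LinearMap.det (L : E3 →ₗ[ℝ] E3) = 1)
    {F : Type*} [NormedAddCommGroup F] {f : S2 → F} {p : ℝ≥0∞} (hf : MemLp f p area) :
    MemLp (fun x => f (sphereMap L x)) p area := by
  have h := hf.of_measure_le_smul ENNReal.coe_ne_top (map_sphereMap_area_le L hL)
  exact h.comp_of_map (continuous_sphereMap L).measurable.aemeasurable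

theorem integrable_comp_sphereMap (L : E3 ≃L[ℝ] E3) (hL : LinearMap.det (L : E3 →ₗ[ℝ] E3) = 1)
    {F : Type*} [NormedAddCommGroup F] {f : S2 → F} (hf : Integrable f area) :
    Integrable (fun x => f (sphereMap L x)) area :=
  memLp_one_iff_integrable.1 (memLp_comp_sphereMap L hL (memLp_one_iff_integrable.2 hf))

theorem integral_comp_sphereMap_le (L : E3 ≃L[ℝ] E3) (hL : LinearMap.det (L : E3 →ₗ[ℝ] E3) = 1)
    {f : S2 → ℝ} (hf : Integrable f area) (h0 : ∀ x, 0 ≤ f x) :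
    ∫ x, f (sphereMap L x) ∂area ≤ ‖(L : E3 →L[ℝ] E3)‖ ^ 3 * ∫ y, f y ∂area := by
  rw [← (measurableEmbedding_sphereMap L).integral_map]
  have h := integral_mono_measure (map_sphereMap_area_le L hL) (ae_of_all _ h0)
    (hf.smul_measure ENNReal.coe_ne_top)
  rw [integral_smul_measure] at h
  simpa using h

theorem quasiMeasurePreserving_sphereMap (L : E3 ≃L[ℝ] E3)
    (hL : LinearMap.det (L : E3 →ₗ[ℝ] E3) = 1) :
    Measure.QuasiMeasurePreserving (sphereMap L) area area :=
  ⟨(continuous_sphereMap L).measurable,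
    (Measure.absolutelyContinuous_of_le_smul (map_sphereMap_area_le L hL))⟩

/-! ### The matrix group and its action. -/

/-- The linear automorphism of space with matrix `H`. -/
def linEquiv (H : SL3) : E3 ≃L[ℝ] E3 :=
  (LinearEquiv.ofLinearMap (Matrix.toEuclideanLin (H : Matrix (Fin 3) (Fin 3) ℝ))
    (Matrix.toEuclideanLin ((H⁻¹ : SL3) : Matrix (Fin 3) (Fin 3) ℝ))
    (by rw [← Matrix.toLpLin_mul_same, ← Matrix.SpecialLinearGroup.coe_mul, mul_inv_cancel,
      Matrix.SpecialLinearGroup.coe_one, Matrix.toLpLin_one])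
    (by rw [← Matrix.toLpLin_mul_same, ← Matrix.SpecialLinearGroup.coe_mul, inv_mul_cancel,
      Matrix.SpecialLinearGroup.coe_one, Matrix.toLpLin_one])).toContinuousLinearEquiv

theorem det_linEquiv (H : SL3) : LinearMap.det (linEquiv H : E3 →ₗ[ℝ] E3) = 1 := by
  rw [← H.det_coe]
  exact LinearMap.det_toLpLin 2 (H : Matrix (Fin 3) (Fin 3) ℝ)

theorem linEquiv_mul (G H : SL3) (x : E3) : linEquiv (G * H) x = linEquiv G (linEquiv H x) := by
  change Matrix.toEuclideanLin ((G * H : SL3) : Matrix (Fin 3) (Fin 3) ℝ) x =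
    Matrix.toEuclideanLin (G : Matrix (Fin 3) (Fin 3) ℝ)
      (Matrix.toEuclideanLin (H : Matrix (Fin 3) (Fin 3) ℝ) x)
  rw [Matrix.SpecialLinearGroup.coe_mul, Matrix.toLpLin_mul_same]
  rfl

theorem linEquiv_one (x : E3) : linEquiv 1 x = x := by
  change Matrix.toEuclideanLin ((1 : SL3) : Matrix (Fin 3) (Fin 3) ℝ) x = x
  rw [Matrix.SpecialLinearGroup.coe_one, Matrix.toLpLin_one]
  rfl

theorem det_linEquiv_symm (H : SL3) : LinearMap.det ((linEquiv H).symm : E3 →ₗ[ℝ] E3) = 1 :=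
  det_linEquiv H⁻¹

theorem mu_eq (H : SL3) (I : S2 → ℝ) : mu H I = fun x => I (sphereMap (linEquiv H) x) := by
  funext x
  simp only [mu, rho, inv_inv, Function.comp_apply]
  rfl

theorem mu_one (I : S2 → ℝ) : mu 1 I = I := by
  rw [mu_eq]
  funext x
  congr 1
  ext1
  simp [coe_sphereMap, linEquiv_one]

/-- Precomposition reverses order, which makes the action a right action; normalizing between the
two linear maps does not affect the final direction. -/
theorem mu_mu (G H : SL3) (I : S2 → ℝ) : mu G (mu H I) = mu (H * G) I := by
  simp only [mu_eq]
  funext x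
  congr 1
  have h : linEquiv H (linEquiv G (x : E3)) ≠ 0 := by simpa using x.ne_zero
  rw [sphereMap.eq_def (linEquiv G), sphereMap_dirPoint _ _ h]
  ext1
  simp [coe_dirPoint, coe_sphereMap, linEquiv_mul]

/-! ### Transport of test fields by a linear map. -/

theorem homogOff_norm_zpow_smul_radialExt {F : Type*} [NormedAddCommGroup F] [NormedSpace ℝ F]
    (k : ℤ) (X : S2 → F) : HomogOff k fun y => ‖y‖ ^ k • radialExt X y := by
  intro t ht y hy
  have h1 := homogOff_norm_zpow k t ht y hy
  have h2 := homogOff_radialExt X t ht y hy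
  simp only at h1 ⊢
  rw [h1, h2, zpow_zero, one_smul, smul_smul, smul_eq_mul]

theorem smoothOff_norm_zpow_smul {F : Type*} [NormedAddCommGroup F] [NormedSpace ℝ F]
    (k : ℤ) {X : E3 → F} (hX : SmoothOff X) : SmoothOff fun y => ‖y‖ ^ k • X y := fun y hy =>
  (smoothOff_norm_zpow _ y hy).smul (hX y hy)

theorem SmoothOff.comp_symm {F : Type*} [NormedAddCommGroup F] [NormedSpace ℝ F] {V : E3 → F}
    (hV : SmoothOff V) (L : E3 ≃L[ℝ] E3) : SmoothOff fun y => V (L.symm y) := fun y hy =>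
  (hV (L.symm y) ((map_ne_zero_iff L.symm L.symm.injective).2 hy)).comp y
    L.symm.contDiff.contDiffAt

theorem HomogOff.comp_symm {F : Type*} [NormedAddCommGroup F] [NormedSpace ℝ F] {V : E3 → F} {k : ℤ}
    (hV : HomogOff k V) (L : E3 ≃L[ℝ] E3) : HomogOff k fun y => V (L.symm y) := fun t ht y hy => by
  simp only [map_smul]
  exact hV t ht _ ((map_ne_zero_iff L.symm L.symm.injective).2 hy)

theorem radialExt_map {F : Type*} [Zero F] (L : E3 ≃L[ℝ] E3) (X : S2 → F) (x : S2) :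
    radialExt X (L (x : E3)) = X (sphereMap L x) :=
  radialExt_of_ne X _

/-- The divergence on the sphere as a divergence in space. -/
theorem divField_eq_ediv_homog {X : S2 → E3} (hX : SmoothOff (radialExt X))
    (htan : IsTangentField X) (x : S2) :
    divField X x = ediv (fun y => ‖y‖ ^ (-2 : ℤ) • radialExt X y) x := by
  rw [← divField_tangentProj (smoothOff_norm_zpow_smul _ hX)
    (homogOff_norm_zpow_smul_radialExt _ X)]
  congr 1
  funext z
  rw [radialExt_coe, norm_eq_of_mem_sphere, one_zpow, one_smul,
    tangentProj_of_inner_eq_zero z (htan z)]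

/-- Degree -3 is the degree of the Jacobian. It dictates the weights -2 for vector fields and -1 for
2-tensors, since each divergence lowers the degree by one. -/
theorem HomogOff.apply_symm {a : E3 → ℝ} (ha : HomogOff (-3) a) (L : E3 ≃L[ℝ] E3) (y : S2) :
    a (L.symm y) = sphereJac L y * a (sphereMap L.symm y) := by
  rw [ha.eq_norm_smul ((map_ne_zero_iff L.symm L.symm.injective).2 y.ne_zero), radialExt_map,
    coe_sphereJac, smul_eq_mul, inv_pow, zpow_neg]
  norm_cast

/-- The transport of a vector field by a linear map, followed by the tangential projection. -/
def pushField (L : E3 ≃L[ℝ] E3) (X : S2 → E3) (y : S2) : E3 :=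
  tangentProj y (L (‖L.symm y‖ ^ (-2 : ℤ) • X (sphereMap L.symm y)))

/-- The transport of a 2-tensor field by a linear map. -/
def pushTensorAux (L : E3 ≃L[ℝ] E3) (T : S2 → E3 →L[ℝ] E3) (y : E3) : E3 →L[ℝ] E3 :=
  (L : E3 →L[ℝ] E3) ∘L (‖L.symm y‖ ^ (-1 : ℤ) • radialExt T (L.symm y)) ∘L
    adjoint (L : E3 →L[ℝ] E3)

theorem contMDiff_tangentProj_apply {V : E3 → E3} (hV : SmoothOff V) :
    ContMDiff (𝓡 2) 𝓘(ℝ, E3) ∞ fun x : S2 => tangentProj x (V x) :=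
  SmoothOff.contMDiff (V := fun y => projAlong y (V y)) fun y hy =>
    contDiff_projAlong.contDiffAt.clm_apply (hV y hy)

theorem isTangentField_tangentProj (V : S2 → E3) : IsTangentField fun x => tangentProj x (V x) :=
  fun x => inner_tangentProj_self x _

theorem smoothOff_push (L : E3 ≃L[ℝ] E3) {X : S2 → E3} (hX : SmoothOff (radialExt X)) :
    SmoothOff fun y => L (‖L.symm y‖ ^ (-2 : ℤ) • radialExt X (L.symm y)) := fun y hy =>
  L.contDiff.contDiffAt.comp y ((smoothOff_norm_zpow_smul (-2) hX).comp_symm L y hy)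

theorem contMDiff_pushField (L : E3 ≃L[ℝ] E3) {X : S2 → E3} (hX : SmoothOff (radialExt X)) :
    ContMDiff (𝓡 2) 𝓘(ℝ, E3) ∞ (pushField L X) :=
  (contMDiff_tangentProj_apply (smoothOff_push L hX)).congr fun x => by
    simp only [radialExt_map, pushField]

/-- A Piola identity: in degree -2, projecting the transported field to the tangent plane does not
change its divergence. -/
theorem divField_pushField (L : E3 ≃L[ℝ] E3) {X : S2 → E3} (hX : SmoothOff (radialExt X))
    (htan : IsTangentField X) (y : S2) :
    divField (pushField L X) y = sphereJac L y * divField X (sphereMap L.symm y) := by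
  have hS := smoothOff_norm_zpow_smul (-2) hX
  have hH := homogOff_norm_zpow_smul_radialExt (-2) X
  have hy : L.symm (y : E3) ≠ 0 := (map_ne_zero_iff L.symm L.symm.injective).2 y.ne_zero
  have h1 : HomogOff (-2) fun y => L (‖L.symm y‖ ^ (-2 : ℤ) • radialExt X (L.symm y)) := by
    intro t ht z hz
    have := hH.comp_symm L t ht z hz
    simp only at this ⊢
    rw [this, map_smul]
  have h2 : pushField L X =
      fun y : S2 => tangentProj y (L (‖L.symm y‖ ^ (-2 : ℤ) • radialExt X (L.symm y))) := by
    funext z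
    simp only [radialExt_map, pushField]
  rw [h2, divField_tangentProj (smoothOff_push L hX) h1,
    ediv_map (V := fun y => ‖y‖ ^ (-2 : ℤ) • radialExt X y) L (hS.differentiableAt hy),
    (hH.ediv hS).apply_symm, divField_eq_ediv_homog hX htan]

theorem smoothOff_pushTensorAux (L : E3 ≃L[ℝ] E3) {T : S2 → E3 →L[ℝ] E3}
    (hT : SmoothOff (radialExt T)) : SmoothOff (pushTensorAux L T) := fun y hy =>
  contDiffAt_const.clm_comp
    (((smoothOff_norm_zpow_smul (-1) hT).comp_symm L y hy).clm_comp contDiffAt_const)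

theorem homogOff_pushTensorAux (L : E3 ≃L[ℝ] E3) (T : S2 → E3 →L[ℝ] E3) :
    HomogOff (-1) (pushTensorAux L T) := by
  intro t ht z hz
  have := (homogOff_norm_zpow_smul_radialExt (-1) T).comp_symm L t ht z hz
  simp only at this
  simp only [pushTensorAux, this]
  ext1 u
  simp

/-- The tangential part of the transported tensor field. -/
def pushTensor (L : E3 ≃L[ℝ] E3) (T : S2 → E3 →L[ℝ] E3) (y : S2) : E3 →L[ℝ] E3 :=
  tangentPart y (pushTensorAux L T y)

/-- The vector field that collects the normal components of the transported tensor field. -/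
def pushTensorNormal (L : E3 ≃L[ℝ] E3) (T : S2 → E3 →L[ℝ] E3) (y : S2) : E3 :=
  tangentProj y (pushTensorAux L T y y + adjoint (pushTensorAux L T y) y)

theorem contMDiff_pushTensor (L : E3 ≃L[ℝ] E3) {T : S2 → E3 →L[ℝ] E3}
    (hT : SmoothOff (radialExt T)) : ContMDiff (𝓡 2) 𝓘(ℝ, E3 →L[ℝ] E3) ∞ (pushTensor L T) :=
  (smoothOff_projAlong_comp (smoothOff_pushTensorAux L hT)).contMDiff

theorem contMDiff_pushTensorNormal (L : E3 ≃L[ℝ] E3) {T : S2 → E3 →L[ℝ] E3}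
    (hT : SmoothOff (radialExt T)) : ContMDiff (𝓡 2) 𝓘(ℝ, E3) ∞ (pushTensorNormal L T) :=
  contMDiff_tangentProj_apply (V := fun y => pushTensorAux L T y y + adjoint (pushTensorAux L T y) y)
    fun y hy => ((smoothOff_pushTensorAux L hT y hy).clm_apply contDiffAt_id).add
      ((smoothOff_adjoint (smoothOff_pushTensorAux L hT) y hy).clm_apply contDiffAt_id)

/-- The second-order Piola identity. The first-order term appears because `L T L*` need not be
tangent. -/
theorem sphereJac_mul_divField_divTensor (L : E3 ≃L[ℝ] E3) {T : S2 → E3 →L[ℝ] E3}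
    (hT : SmoothOff (radialExt T)) (htan : IsTangentTensor T) (y : S2) :
    sphereJac L y * divField (divTensor T) (sphereMap L.symm y) =
      divField (divTensor (pushTensor L T)) y + divField (pushTensorNormal L T) y := by
  have hS := smoothOff_norm_zpow_smul (-1) hT
  have hH := homogOff_norm_zpow_smul_radialExt (-1) T
  have hne : ∀ z : E3, z ≠ 0 → L.symm z ≠ 0 := fun z hz =>
    (map_ne_zero_iff L.symm L.symm.injective).2 hz
  have h := ediv_tdiv_eq (smoothOff_pushTensorAux L hT) (homogOff_pushTensorAux L T) y
  have h1 : ∀ z : E3, z ≠ 0 → tdiv (pushTensorAux L T) z =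
      L (tdiv (fun y => ‖y‖ ^ (-1 : ℤ) • radialExt T y) (L.symm z)) := fun z hz =>
    tdiv_map (M := fun y => ‖y‖ ^ (-1 : ℤ) • radialExt T y) L (hS.differentiableAt (hne z hz))
  rw [ediv_congr h1 y.ne_zero, ediv_map L (hS.tdiv.differentiableAt (hne _ y.ne_zero)),
    ((hH.tdiv hS).ediv hS.tdiv).apply_symm, ← divField_divTensor hT htan] at h
  exact h

theorem continuous_divField {X : S2 → E3} (hX : SmoothOff (radialExt X)) (htan : IsTangentField X) :
    Continuous (divField X) := by
  rw [funext (divField_eq_ediv_homog hX htan)]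
  exact (smoothOff_norm_zpow_smul _ hX).ediv.continuous

theorem continuous_divField_divTensor {T : S2 → E3 →L[ℝ] E3} (hT : SmoothOff (radialExt T))
    (htan : IsTangentTensor T) : Continuous (divField (divTensor T)) := by
  rw [funext (divField_divTensor hT htan)]
  exact (smoothOff_norm_zpow_smul _ hT).tdiv.ediv.continuous

/-! ### Tensor pairings and the dual pull-backs. -/

theorem tensorInner_add_left (A B C : E3 →L[ℝ] E3) :
    tensorInner (A + B) C = tensorInner A C + tensorInner B C := by
  simp [tensorInner, inner_add_left, Finset.sum_add_distrib]

theorem tensorInner_sub_left (A B C : E3 →L[ℝ] E3) :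
    tensorInner (A - B) C = tensorInner A C - tensorInner B C := by
  simp [tensorInner, inner_sub_left, Finset.sum_sub_distrib]

theorem tensorInner_smul_left (c : ℝ) (A C : E3 →L[ℝ] E3) :
    tensorInner (c • A) C = c * tensorInner A C := by
  simp [tensorInner, inner_smul_left, Finset.mul_sum]

theorem tensorInner_smul_right (c : ℝ) (A C : E3 →L[ℝ] E3) :
    tensorInner A (c • C) = c * tensorInner A C := by
  simp [tensorInner, inner_smul_right, Finset.mul_sum]

/-- Cyclicity of the trace in the Hilbert–Schmidt pairing, by expanding in the basis and exchanging
the sums. -/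
theorem tensorInner_comp (A P C Q : E3 →L[ℝ] E3) :
    tensorInner A (P ∘L C ∘L Q) = tensorInner (adjoint P ∘L A ∘L adjoint Q) C := by
  have h1 : ∀ i, ⟪A (stdVec i), P (C (Q (stdVec i)))⟫_ℝ =
      ∑ k, ⟪stdVec k, Q (stdVec i)⟫_ℝ * ⟪A (stdVec i), P (C (stdVec k))⟫_ℝ := by
    intro i
    have := sum_inner_smul_map ((innerSL ℝ (A (stdVec i))).comp (P.comp C)) (Q (stdVec i))
    simpa using this.symm
  have h2 : ∀ k, ⟪adjoint P (A (adjoint Q (stdVec k))), C (stdVec k)⟫_ℝ =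
      ∑ i, ⟪stdVec k, Q (stdVec i)⟫_ℝ * ⟪A (stdVec i), P (C (stdVec k))⟫_ℝ := by
    intro k
    have := sum_inner_smul_map ((innerSL ℝ (P (C (stdVec k)))).comp A) (adjoint Q (stdVec k))
    rw [ContinuousLinearMap.adjoint_inner_left, real_inner_comm]
    simp only [ContinuousLinearMap.comp_apply, innerSL_apply_apply, smul_eq_mul,
      ContinuousLinearMap.adjoint_inner_right] at this
    rw [← this]
    refine Finset.sum_congr rfl fun i _ => ?_
    rw [real_inner_comm (stdVec k), real_inner_comm (A (stdVec i))]
  simp only [tensorInner, ContinuousLinearMap.comp_apply, h1, h2]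
  exact Finset.sum_comm

theorem adjoint_tangentProj (x : S2) : adjoint (tangentProj x) = tangentProj x := by
  refine (ContinuousLinearMap.eq_adjoint_iff _ _).2 (fun u v => inner_tangentProj_left x u v) |>.symm

theorem tensorInner_tangentPart (x : S2) (A C : E3 →L[ℝ] E3) :
    tensorInner A (tangentPart x C) = tensorInner (tangentPart x A) C := by
  rw [tangentPart, tensorInner_comp, adjoint_tangentProj, tangentPart]

theorem tangentPart_of_isTangentTensor {B : S2 → E3 →L[ℝ] E3} (hB : IsTangentTensor B) (x : S2) :
    tangentPart x (B x) = B x := by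
  ext1 u
  simp only [tangentPart, ContinuousLinearMap.comp_apply]
  rw [tangentProj_of_inner_eq_zero x ((hB x).2 _), tangentProj_apply, map_sub, map_smul, (hB x).1,
    smul_zero, sub_zero]

theorem tensorInner_smulRight (a b : E3) (C : E3 →L[ℝ] E3) :
    tensorInner ((innerSL ℝ b).smulRight a) C = ⟪a, C b⟫_ℝ := by
  rw [← sum_inner_smul_map C b, inner_sum]
  refine Finset.sum_congr rfl fun i _ => ?_
  simp [inner_smul_left, inner_smul_right, real_inner_comm]

/-- The pull-back of a weak gradient. -/
def pullGrad (L : E3 ≃L[ℝ] E3) (g : S2 → E3) (x : S2) : E3 :=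
  ‖L x‖⁻¹ • tangentProj x (adjoint (L : E3 →L[ℝ] E3) (g (sphereMap L x)))

/-- The symmetric product of two vectors, as an endomorphism. -/
def symProd (a b : E3) : E3 →L[ℝ] E3 := (innerSL ℝ b).smulRight a + (innerSL ℝ a).smulRight b

/-- The pull-back of a weak Hessian. -/
def pullHess (L : E3 ≃L[ℝ] E3) (g : S2 → E3) (B : S2 → E3 →L[ℝ] E3) (x : S2) : E3 →L[ℝ] E3 :=
  ‖L x‖⁻¹ ^ 2 • tangentPart x
    (adjoint (L : E3 →L[ℝ] E3) ∘L B (sphereMap L x) ∘L (L : E3 →L[ℝ] E3) -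
      symProd (adjoint (L : E3 →L[ℝ] E3) (g (sphereMap L x)))
        (adjoint (L : E3 →L[ℝ] E3) (sphereMap L x)))

theorem pushTensorAux_sphereMap (L : E3 ≃L[ℝ] E3) (T : S2 → E3 →L[ℝ] E3) (x : S2) :
    pushTensorAux L T (sphereMap L x) =
      ‖L x‖ • ((L : E3 →L[ℝ] E3) ∘L T x ∘L adjoint (L : E3 →L[ℝ] E3)) := by
  rw [pushTensorAux, norm_symm_coe_sphereMap, radialExt_map, sphereMap_symm_sphereMap]
  ext1 u
  simp

/-- `pullGrad` is the pointwise adjoint of `pushField`, Jacobian included: `|Lx|⁻³` times the weight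
`|Lx|²` leaves `|Lx|⁻¹`. Tangency of `g` and `X` lets the projections be dropped. -/
theorem inner_pullGrad (L : E3 ≃L[ℝ] E3) {g : S2 → E3} (hg : IsTangentField g) {X : S2 → E3}
    (hX : IsTangentField X) (x : S2) :
    sphereJac L.symm x * ⟪g (sphereMap L x), pushField L X (sphereMap L x)⟫_ℝ =
      ⟪pullGrad L g x, X x⟫_ℝ := by
  have hn := (norm_map_pos L x).ne'
  rw [pushField, norm_symm_coe_sphereMap, sphereMap_symm_sphereMap, pullGrad, coe_sphereJac,
    inner_smul_left, inner_tangentProj_left, tangentProj_of_inner_eq_zero x (hX x),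
    ← inner_tangentProj_left, tangentProj_of_inner_eq_zero _ (hg _), map_smul, inner_smul_right,
    ContinuousLinearMap.adjoint_inner_left, ← mul_assoc]
  congr 1
  rw [ContinuousLinearEquiv.symm_symm, inv_zpow, zpow_neg, inv_inv]
  simp only [RCLike.conj_to_real]
  rw [zpow_ofNat]
  field_simp

/-- Here the powers are `|Lx|⁻³ · |Lx| = |Lx|⁻²`. The term `symProd` is dual to the normal field;
its minus sign is the one in the definition of the weak gradient. -/
theorem tensorInner_pullHess (L : E3 ≃L[ℝ] E3) {g : S2 → E3} (hg : IsTangentField g)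
    {B : S2 → E3 →L[ℝ] E3} (hB : IsTangentTensor B) {T : S2 → E3 →L[ℝ] E3}
    (hT : IsTangentTensor T) (x : S2) :
    sphereJac L.symm x * (tensorInner (B (sphereMap L x)) (pushTensor L T (sphereMap L x)) -
      ⟪g (sphereMap L x), pushTensorNormal L T (sphereMap L x)⟫_ℝ) =
        tensorInner (pullHess L g B x) (T x) := by
  have hn := (norm_map_pos L x).ne'
  rw [pushTensor, tensorInner_tangentPart, tangentPart_of_isTangentTensor hB, pushTensorNormal,
    ← inner_tangentProj_left, tangentProj_of_inner_eq_zero _ (hg _), pushTensorAux_sphereMap,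
    tensorInner_smul_right, tensorInner_comp, ContinuousLinearMap.adjoint_adjoint, pullHess,
    tensorInner_smul_left, ← tensorInner_tangentPart, tangentPart_of_isTangentTensor hT,
    tensorInner_sub_left, symProd, tensorInner_add_left, tensorInner_smulRight,
    tensorInner_smulRight, inner_add_right, ContinuousLinearMap.adjoint_inner_right,
    coe_sphereJac]
  simp only [smul_apply, ContinuousLinearMap.comp_apply, inner_smul_right,
    ContinuousLinearMap.adjoint_inner_left, ContinuousLinearEquiv.symm_symm,
    ContinuousLinearEquiv.coe_coe, real_inner_comm (sphereMap L x : E3)]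
  field_simp

theorem integral_eq_sphereJac_mul (L : E3 ≃L[ℝ] E3)
    (hL : LinearMap.det (L.symm : E3 →ₗ[ℝ] E3) = 1) (f : S2 → ℝ) :
    ∫ y, f y ∂area = ∫ x, sphereJac L.symm x * f (sphereMap L x) ∂area := by
  rw [← integral_comp_sphereMap L.symm hL fun x => f (sphereMap L x)]
  congr 1
  funext y
  have := sphereMap_symm_sphereMap L.symm y
  rw [ContinuousLinearEquiv.symm_symm] at this
  rw [this]

/-! ### Pointwise bounds and integrability of the pull-backs. -/

instance : IsFiniteMeasure area := inferInstanceAs (IsFiniteMeasure (volume : Measure E3).toSphere)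

theorem norm_tangentProj_apply_le (x : S2) (u : E3) : ‖tangentProj x u‖ ≤ ‖u‖ := by
  have h1 : ⟪tangentProj x u, tangentProj x u⟫_ℝ = ⟪u, tangentProj x u⟫_ℝ := by
    rw [inner_tangentProj_left, tangentProj_idem]
  have h2 := real_inner_le_norm u (tangentProj x u)
  rw [← h1, real_inner_self_eq_norm_sq] at h2
  by_contra! h
  nlinarith [norm_nonneg u]

theorem norm_tangentPart_le (x : S2) (A : E3 →L[ℝ] E3) : ‖tangentPart x A‖ ≤ ‖A‖ := by
  refine ContinuousLinearMap.opNorm_le_bound _ (norm_nonneg _) fun u => ?_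
  exact (norm_tangentProj_apply_le x _).trans ((A.le_opNorm _).trans
    (mul_le_mul_of_nonneg_left (norm_tangentProj_apply_le x u) (norm_nonneg _)))

theorem norm_symProd_le (a b : E3) : ‖symProd a b‖ ≤ 2 * ‖a‖ * ‖b‖ := by
  refine (norm_add_le _ _).trans (le_of_eq ?_)
  simp only [ContinuousLinearMap.norm_smulRight_apply, innerSL_apply_norm]
  ring

theorem norm_adjoint_coe (L : E3 ≃L[ℝ] E3) :
    ‖adjoint (L : E3 →L[ℝ] E3)‖ = ‖(L : E3 →L[ℝ] E3)‖ := LinearIsometryEquiv.norm_map adjoint _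

theorem norm_pullGrad_le (L : E3 ≃L[ℝ] E3) (g : S2 → E3) (x : S2) :
    ‖pullGrad L g x‖ ≤
      ‖(L.symm : E3 →L[ℝ] E3)‖ * ‖(L : E3 →L[ℝ] E3)‖ * ‖g (sphereMap L x)‖ := by
  rw [pullGrad, norm_smul, norm_inv, norm_norm, mul_assoc]
  refine mul_le_mul (inv_norm_map_le L x) ?_ (norm_nonneg _) (norm_nonneg _)
  refine (norm_tangentProj_apply_le x _).trans ?_
  rw [← norm_adjoint_coe]
  exact ContinuousLinearMap.le_opNorm _ _

theorem norm_pullHess_le (L : E3 ≃L[ℝ] E3) (g : S2 → E3) (B : S2 → E3 →L[ℝ] E3) (x : S2) :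
    ‖pullHess L g B x‖ ≤ (‖(L.symm : E3 →L[ℝ] E3)‖ * ‖(L : E3 →L[ℝ] E3)‖) ^ 2 *
      (‖B (sphereMap L x)‖ + 2 * ‖g (sphereMap L x)‖) := by
  rw [pullHess, norm_smul, norm_pow, norm_inv, norm_norm, mul_pow, mul_assoc]
  refine mul_le_mul (pow_le_pow_left₀ (by positivity) (inv_norm_map_le L x) 2) ?_ (norm_nonneg _)
    (by positivity)
  refine (norm_tangentPart_le x _).trans ((norm_sub_le _ _).trans ?_)
  rw [mul_add]
  refine add_le_add ?_ ?_
  · refine (ContinuousLinearMap.opNorm_comp_le _ _).trans ?_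
    rw [norm_adjoint_coe, sq, mul_assoc]
    refine mul_le_mul_of_nonneg_left ?_ (norm_nonneg _)
    rw [mul_comm]
    exact ContinuousLinearMap.opNorm_comp_le _ _
  · refine (norm_symProd_le _ _).trans ?_
    have h1 := (adjoint (L : E3 →L[ℝ] E3)).le_opNorm (g (sphereMap L x))
    have h2 := (adjoint (L : E3 →L[ℝ] E3)).le_opNorm (sphereMap L x)
    rw [norm_adjoint_coe] at h1 h2
    rw [norm_eq_of_mem_sphere, mul_one] at h2
    calc _ ≤ 2 * (‖(L : E3 →L[ℝ] E3)‖ * ‖g (sphereMap L x)‖) * ‖(L : E3 →L[ℝ] E3)‖ := by gcongr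
      _ = _ := by ring

theorem continuous_tangentProj : Continuous tangentProj :=
  contDiff_projAlong.continuous.comp continuous_subtype_val

theorem continuous_inv_norm_map (L : E3 ≃L[ℝ] E3) : Continuous fun x : S2 => ‖L (x : E3)‖⁻¹ :=
  (L.continuous.comp continuous_subtype_val).norm.inv₀ fun x => (norm_map_pos L x).ne'

theorem memLp_pullGrad (L : E3 ≃L[ℝ] E3) (hL : LinearMap.det (L : E3 →ₗ[ℝ] E3) = 1) {p : ℝ≥0∞}
    {g : S2 → E3} (hg : MemLp g p area) : MemLp (pullGrad L g) p area := by
  have h := memLp_comp_sphereMap L hL hg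
  refine h.of_le_mul ?_ (ae_of_all _ (norm_pullGrad_le L g))
  refine (continuous_inv_norm_map L).aestronglyMeasurable.smul ?_
  have hc : Continuous fun q : (E3 →L[ℝ] E3) × E3 => q.1 (adjoint (L : E3 →L[ℝ] E3) q.2) := by
    fun_prop
  exact hc.comp_aestronglyMeasurable
    (continuous_tangentProj.aestronglyMeasurable.prodMk h.aestronglyMeasurable)

theorem continuous_symProd : Continuous fun q : E3 × E3 => symProd q.1 q.2 := by
  have hi : ContDiff ℝ ∞ fun q : E3 => innerSL ℝ q := (innerSL ℝ).contDiff
  exact (((hi.comp contDiff_snd).smulRight contDiff_fst).add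
    ((hi.comp contDiff_fst).smulRight contDiff_snd)).continuous

theorem aestronglyMeasurable_clm_comp {A B : S2 → E3 →L[ℝ] E3}
    (hA : AEStronglyMeasurable A area) (hB : AEStronglyMeasurable B area) :
    AEStronglyMeasurable (fun x => A x ∘L B x) area :=
  (continuous_fst.clm_comp continuous_snd : Continuous fun q : (E3 →L[ℝ] E3) × (E3 →L[ℝ] E3) =>
    q.1 ∘L q.2).comp_aestronglyMeasurable (hA.prodMk hB)

theorem memLp_pullHess (L : E3 ≃L[ℝ] E3) (hL : LinearMap.det (L : E3 →ₗ[ℝ] E3) = 1) {p : ℝ≥0∞}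
    {g : S2 → E3} {B : S2 → E3 →L[ℝ] E3} (hg : MemLp g p area) (hB : MemLp B p area) :
    MemLp (pullHess L g B) p area := by
  have h := memLp_comp_sphereMap L hL hg
  have h' := memLp_comp_sphereMap L hL hB
  have hsum := h'.norm.add (h.norm.const_mul 2)
  refine hsum.of_le_mul (c := (‖(L.symm : E3 →L[ℝ] E3)‖ * ‖(L : E3 →L[ℝ] E3)‖) ^ 2) ?_
    (ae_of_all _ fun x => ?_)
  · have hP := continuous_tangentProj.aestronglyMeasurable (μ := area)
    have hLc := (adjoint (L : E3 →L[ℝ] E3)).continuous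
    have hs := continuous_symProd.comp_aestronglyMeasurable
      ((hLc.comp_aestronglyMeasurable h.aestronglyMeasurable).prodMk (hLc.comp
        (continuous_subtype_val.comp (continuous_sphereMap L))).aestronglyMeasurable)
    exact ((continuous_inv_norm_map L).pow 2).aestronglyMeasurable.smul
      (aestronglyMeasurable_clm_comp hP (aestronglyMeasurable_clm_comp
        ((aestronglyMeasurable_clm_comp aestronglyMeasurable_const (aestronglyMeasurable_clm_comp
          h'.aestronglyMeasurable aestronglyMeasurable_const)).sub hs) hP))
  · refine (norm_pullHess_le L g B x).trans (mul_le_mul_of_nonneg_left ?_ (by positivity))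
    exact le_abs_self _

theorem exists_norm_bound {F : Type*} [NormedAddCommGroup F] {X : S2 → F} (hX : Continuous X) :
    ∃ C, ∀ x, ‖X x‖ ≤ C := by
  obtain ⟨C, hC⟩ := isCompact_univ.exists_bound_of_continuousOn hX.continuousOn
  exact ⟨C, fun x => hC x (Set.mem_univ x)⟩

theorem integrable_mul_continuous {f D : S2 → ℝ} (hf : Integrable f area) (hD : Continuous D) :
    Integrable (fun x => f x * D x) area := by
  obtain ⟨C, hC⟩ := exists_norm_bound hD
  exact hf.mul_bdd (c := C) hD.aestronglyMeasurable (ae_of_all _ hC)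

theorem integrable_inner_continuous {g X : S2 → E3} (hg : Integrable g area) (hX : Continuous X) :
    Integrable (fun x => ⟪g x, X x⟫_ℝ) area := by
  obtain ⟨C, hC⟩ := exists_norm_bound hX
  refine (hg.norm.mul_const C).mono' (hg.aestronglyMeasurable.inner hX.aestronglyMeasurable)
    (ae_of_all _ fun x => (norm_inner_le_norm _ _).trans ?_)
  exact mul_le_mul_of_nonneg_left (hC x) (norm_nonneg _)

theorem integrable_tensorInner_continuous {B T : S2 → E3 →L[ℝ] E3} (hB : Integrable B area)
    (hT : Continuous T) : Integrable (fun x => tensorInner (B x) (T x)) area :=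
  integrable_finsetSum _ fun i _ => integrable_inner_continuous
    (hB.apply_continuousLinearMap (stdVec i)) (hT.clm_apply continuous_const)

/-! ### Weak derivatives of a composition. -/

/-- The weak gradient of a composition with `sphereMap L`. -/
theorem IsWeakGradient.comp_sphereMap (L : E3 ≃L[ℝ] E3)
    (hL : LinearMap.det (L : E3 →ₗ[ℝ] E3) = 1) (hL' : LinearMap.det (L.symm : E3 →ₗ[ℝ] E3) = 1)
    {f : S2 → ℝ} {g : S2 → E3} (h : IsWeakGradient f g) :
    IsWeakGradient (fun x => f (sphereMap L x)) (pullGrad L g) := by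
  obtain ⟨hf, hg, htan, hw⟩ := h
  refine ⟨integrable_comp_sphereMap L hL hf, memLp_one_iff_integrable.1
    (memLp_pullGrad L hL (memLp_one_iff_integrable.2 hg)), fun x => ?_, fun X hX hXt => ?_⟩
  · rw [pullGrad, inner_smul_left, inner_tangentProj_self, mul_zero]
  have hS := smoothOff_radialExt hX
  -- The whole integrand is written as a function of `sphereMap L x`, so the change of variables
  -- supplies the Jacobian that the Piola identity absorbs.
  have h1 := integral_comp_sphereMap L hL fun y => f y * divField X (sphereMap L.symm y)
  simp only [sphereMap_symm_sphereMap] at h1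
  rw [h1]
  have h2 : ∀ y, sphereJac L y * (f y * divField X (sphereMap L.symm y)) =
      f y * divField (pushField L X) y := fun y => by
    rw [divField_pushField L hS hXt]
    ring
  simp_rw [h2]
  rw [hw _ (contMDiff_pushField L hS) (isTangentField_tangentProj _),
    integral_eq_sphereJac_mul L hL']
  simp_rw [inner_pullGrad L htan hXt]

/-- The weak Hessian of a composition with `sphereMap L`. -/
theorem IsWeakHessian.comp_sphereMap (L : E3 ≃L[ℝ] E3)
    (hL : LinearMap.det (L : E3 →ₗ[ℝ] E3) = 1) (hL' : LinearMap.det (L.symm : E3 →ₗ[ℝ] E3) = 1)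
    {f : S2 → ℝ} {g : S2 → E3} {B : S2 → E3 →L[ℝ] E3} (hfg : IsWeakGradient f g)
    (hfB : IsWeakHessian f B) :
    IsWeakHessian (fun x => f (sphereMap L x)) (pullHess L g B) := by
  obtain ⟨hf, hg, hgt, hgw⟩ := hfg
  obtain ⟨-, hB, hBt, hBw⟩ := hfB
  refine ⟨integrable_comp_sphereMap L hL hf, memLp_one_iff_integrable.1
    (memLp_pullHess L hL (memLp_one_iff_integrable.2 hg) (memLp_one_iff_integrable.2 hB)),
    fun x => ?_, fun T hT hTt => ?_⟩
  · have h := isTangentTensor_tangentPart (fun _ =>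
      (adjoint (L : E3 →L[ℝ] E3) ∘L B (sphereMap L x) ∘L (L : E3 →L[ℝ] E3) -
      symProd (adjoint (L : E3 →L[ℝ] E3) (g (sphereMap L x)))
        (adjoint (L : E3 →L[ℝ] E3) (sphereMap L x)))) x
    refine ⟨?_, fun u => ?_⟩
    · rw [pullHess, smul_apply, h.1, smul_zero]
    · rw [pullHess, smul_apply, inner_smul_left, h.2, mul_zero]
  have hS := smoothOff_radialExt hT
  have hT' := contMDiff_pushTensor L hS
  have hTt' : IsTangentTensor (pushTensor L T) :=
    isTangentTensor_tangentPart fun x => pushTensorAux L T x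
  have hZ := contMDiff_pushTensorNormal L hS
  have hZt : IsTangentField (pushTensorNormal L T) := isTangentField_tangentProj _
  have h1 := integral_comp_sphereMap L hL fun y =>
    f y * divField (divTensor T) (sphereMap L.symm y)
  simp only [sphereMap_symm_sphereMap] at h1
  rw [h1]
  have h2 : ∀ y, sphereJac L y * (f y * divField (divTensor T) (sphereMap L.symm y)) =
      f y * divField (divTensor (pushTensor L T)) y + f y * divField (pushTensorNormal L T) y :=
    fun y => by
    rw [← mul_add, ← sphereJac_mul_divField_divTensor L hS hTt]
    ring
  simp_rw [h2]
  -- The weak Hessian is tested on `pushTensor` and the weak gradient on `pushTensorNormal`.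
  rw [integral_add
      (integrable_mul_continuous hf (continuous_divField_divTensor (smoothOff_radialExt hT') hTt'))
      (integrable_mul_continuous hf (continuous_divField (smoothOff_radialExt hZ) hZt)),
    hBw _ hT' hTt', hgw _ hZ hZt, ← sub_eq_add_neg,
    ← integral_sub (integrable_tensorInner_continuous hB hT'.continuous)
      (integrable_inner_continuous hg hZ.continuous), integral_eq_sphereJac_mul L hL']
  simp_rw [tensorInner_pullHess L hgt hBt hTt]

/-! ### Uniqueness of weak derivatives and passage to classes. -/

theorem ae_eq_of_inner_stdVec {g g' : S2 → E3}
    (h : ∀ i, ∀ᵐ x ∂area, ⟪g x - g' x, stdVec i⟫_ℝ = 0) : g =ᵐ[area] g' := by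
  filter_upwards [ae_all_iff.2 h] with x hx
  rw [← sub_eq_zero, ← sum_inner_smul_stdVec (g x - g' x)]
  exact Finset.sum_eq_zero fun i _ => by rw [real_inner_comm, hx i, zero_smul]

theorem ae_eq_zero_of_integral_contMDiff_mul {f : S2 → ℝ} (hf : Integrable f area)
    (h : ∀ χ : S2 → ℝ, ContMDiff (𝓡 2) 𝓘(ℝ, ℝ) ∞ χ → ∫ x, χ x * f x ∂area = 0) :
    ∀ᵐ x ∂area, f x = 0 :=
  have : IsManifold (𝓡 2) ∞ S2 := inferInstance
  ae_eq_zero_of_integral_contMDiff_smul_eq_zero (𝓡 2) hf.locallyIntegrable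
    fun χ hχ _ => by simpa using h χ hχ

theorem smoothOff_const {F : Type*} [NormedAddCommGroup F] [NormedSpace ℝ F] (v : F) :
    SmoothOff fun _ : E3 => v := fun _ _ => contDiffAt_const

/-- Weak gradients are unique. -/
theorem IsWeakGradient.ae_eq {f : S2 → ℝ} {g g' : S2 → E3} (h : IsWeakGradient f g)
    (h' : IsWeakGradient f g') : g =ᵐ[area] g' := by
  refine ae_eq_of_inner_stdVec fun i => ae_eq_zero_of_integral_contMDiff_mul
    ((h.2.1.sub h'.2.1).inner_const (𝕜 := ℝ) (stdVec i)) fun χ hχ => ?_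
  -- Projecting `stdVec i` makes the test field admissible and leaves its pairing with tangent
  -- fields unchanged, so `χ` tests a single component of `g - g'`.
  have hX : ContMDiff (𝓡 2) 𝓘(ℝ, E3) ∞ fun x => χ x • tangentProj x (stdVec i) :=
    hχ.smul (contMDiff_tangentProj_apply (smoothOff_const (stdVec i)))
  have hXt : IsTangentField fun x => χ x • tangentProj x (stdVec i) := fun x => by
    rw [inner_smul_left, inner_tangentProj_self, mul_zero]
  have h1 := (h.2.2.2 _ hX hXt).symm.trans (h'.2.2.2 _ hX hXt)
  rw [neg_inj, ← sub_eq_zero, ← integral_sub (integrable_inner_continuous h.2.1 hX.continuous)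
    (integrable_inner_continuous h'.2.1 hX.continuous)] at h1
  rw [← h1]
  congr 1
  funext x
  rw [inner_smul_right, inner_smul_right, ← inner_tangentProj_left, ← inner_tangentProj_left,
    tangentProj_of_inner_eq_zero x (h.2.2.1 x), tangentProj_of_inner_eq_zero x (h'.2.2.1 x),
    inner_sub_left, mul_sub]

theorem tensorInner_comm (A B : E3 →L[ℝ] E3) : tensorInner A B = tensorInner B A := by
  simp [tensorInner, real_inner_comm]

/-- Weak Hessians are unique. -/
theorem IsWeakHessian.ae_eq {f : S2 → ℝ} {B B' : S2 → E3 →L[ℝ] E3} (h : IsWeakHessian f B)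
    (h' : IsWeakHessian f B') : B =ᵐ[area] B' := by
  have key : ∀ i, (fun x => B x (stdVec i)) =ᵐ[area] fun x => B' x (stdVec i) := by
    intro i
    refine ae_eq_of_inner_stdVec fun j => ae_eq_zero_of_integral_contMDiff_mul
      (((h.2.1.apply_continuousLinearMap (stdVec i)).sub
        (h'.2.1.apply_continuousLinearMap (stdVec i))).inner_const (𝕜 := ℝ) (stdVec j))
        fun χ hχ => ?_
    -- A matrix unit: pairing with it isolates one matrix entry of `B - B'`.
    set C : E3 →L[ℝ] E3 := (innerSL ℝ (stdVec i)).smulRight (stdVec j)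
    have hX : ContMDiff (𝓡 2) 𝓘(ℝ, E3 →L[ℝ] E3) ∞ fun x => χ x • tangentPart x C :=
      hχ.smul (smoothOff_projAlong_comp (smoothOff_const C)).contMDiff
    have hXt : IsTangentTensor fun x => χ x • tangentPart x C := fun x => by
      have ht := isTangentTensor_tangentPart (fun _ => C) x
      refine ⟨?_, fun u => ?_⟩
      · rw [smul_apply, ht.1, smul_zero]
      · rw [smul_apply, inner_smul_left, ht.2, mul_zero]
    have h1 := (h.2.2.2 _ hX hXt).symm.trans (h'.2.2.2 _ hX hXt)
    rw [← sub_eq_zero, ← integral_sub (integrable_tensorInner_continuous h.2.1 hX.continuous)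
      (integrable_tensorInner_continuous h'.2.1 hX.continuous)] at h1
    rw [← h1]
    congr 1
    funext x
    rw [tensorInner_smul_right, tensorInner_smul_right, tensorInner_tangentPart,
      tensorInner_tangentPart, tangentPart_of_isTangentTensor h.2.2.1,
      tangentPart_of_isTangentTensor h'.2.2.1, tensorInner_comm (B x), tensorInner_comm (B' x),
      tensorInner_smulRight, tensorInner_smulRight, ← mul_sub, ← inner_sub_right, real_inner_comm]
  filter_upwards [ae_all_iff.2 key] with x hx
  ext1 u
  rw [← sum_inner_smul_map (B x), ← sum_inner_smul_map (B' x)]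
  simp only [hx]

theorem IsWeakGradient.congr {f f' : S2 → ℝ} {g : S2 → E3} (h : IsWeakGradient f g)
    (hff : f =ᵐ[area] f') : IsWeakGradient f' g :=
  ⟨h.1.congr hff, h.2.1, h.2.2.1, fun X hX hXt => by
    rw [← h.2.2.2 X hX hXt]
    exact integral_congr_ae (by filter_upwards [hff] with x hx; rw [hx])⟩

theorem IsWeakHessian.congr {f f' : S2 → ℝ} {B : S2 → E3 →L[ℝ] E3} (h : IsWeakHessian f B)
    (hff : f =ᵐ[area] f') : IsWeakHessian f' B :=
  ⟨h.1.congr hff, h.2.1, h.2.2.1, fun T hT hTt => by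
    rw [← h.2.2.2 T hT hTt]
    exact integral_congr_ae (by filter_upwards [hff] with x hx; rw [hx])⟩

theorem mem_W22_congr {f f' : S2 → ℝ} (hf : f ∈ W22) (hff : f =ᵐ[area] f') : f' ∈ W22 := by
  obtain ⟨h, ⟨g, hg, hg2⟩, B, hB, hB2⟩ := hf
  exact ⟨(memLp_congr_ae hff).1 h, ⟨g, hg.congr hff, hg2⟩, B, hB.congr hff, hB2⟩

theorem mu_mem_W22 (H : SL3) {I : S2 → ℝ} (hI : I ∈ W22) : mu H I ∈ W22 := by
  obtain ⟨h, ⟨g, hg, hg2⟩, B, hB, hB2⟩ := hI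
  have hL := det_linEquiv H
  have hL' := det_linEquiv_symm H
  rw [mu_eq]
  exact ⟨memLp_comp_sphereMap _ hL h, ⟨_, hg.comp_sphereMap _ hL hL', memLp_pullGrad _ hL hg2⟩,
    _, IsWeakHessian.comp_sphereMap _ hL hL' hg hB, memLp_pullHess _ hL hg2 hB2⟩

theorem mu_congr_ae (H : SL3) {f f' : S2 → ℝ} (h : f =ᵐ[area] f') : mu H f =ᵐ[area] mu H f' := by
  rw [mu_eq, mu_eq]
  exact (quasiMeasurePreserving_sphereMap _ (det_linEquiv H)).ae_eq_comp h

/-! ### The L² estimates. -/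

/-- Cauchy–Schwarz on coordinates. The comparison is needed because `MemLp` refers to the operator
norm while the final bound uses the Hilbert–Schmidt norm. -/
theorem norm_sq_le_tensorInner (A : E3 →L[ℝ] E3) : ‖A‖ ^ 2 ≤ tensorInner A A := by
  have h0 : 0 ≤ tensorInner A A := Finset.sum_nonneg fun i _ => real_inner_self_nonneg
  have h : ‖A‖ ≤ √(tensorInner A A) := by
    refine ContinuousLinearMap.opNorm_le_bound _ (Real.sqrt_nonneg _) fun u => ?_
    refine le_of_sq_le_sq ?_ (by positivity)
    rw [mul_pow, Real.sq_sqrt h0]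
    have h1 : ‖A u‖ ≤ ∑ i, ‖A (stdVec i)‖ * |⟪stdVec i, u⟫_ℝ| := by
      rw [← sum_inner_smul_map A u]
      refine (norm_sum_le _ _).trans (le_of_eq ?_)
      simp [norm_smul, mul_comm]
    have h2 : ‖u‖ ^ 2 = ∑ i, |⟪stdVec i, u⟫_ℝ| ^ 2 := by
      rw [← real_inner_self_eq_norm_sq, ← sum_inner_mul_inner]
      refine Finset.sum_congr rfl fun i _ => ?_
      rw [sq_abs, real_inner_comm, sq]
    have h3 : tensorInner A A = ∑ i, ‖A (stdVec i)‖ ^ 2 := by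
      simp [tensorInner]
    rw [h2, h3]
    exact (pow_le_pow_left₀ (norm_nonneg _) h1 2).trans (Finset.sum_mul_sq_le_sq_mul_sq _ _ _)
  calc ‖A‖ ^ 2 ≤ √(tensorInner A A) ^ 2 := pow_le_pow_left₀ (norm_nonneg _) h 2
    _ = _ := Real.sq_sqrt h0

theorem tensorInner_self_le (A : E3 →L[ℝ] E3) : tensorInner A A ≤ 3 * ‖A‖ ^ 2 := by
  have h : ∀ i : Fin 3, ⟪A (stdVec i), A (stdVec i)⟫_ℝ ≤ ‖A‖ ^ 2 := fun i => by
    rw [real_inner_self_eq_norm_sq]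
    refine pow_le_pow_left₀ (norm_nonneg _) ?_ 2
    simpa [stdVec] using A.le_opNorm (stdVec i)
  calc tensorInner A A ≤ ∑ _i : Fin 3, ‖A‖ ^ 2 := Finset.sum_le_sum fun i _ => h i
    _ = _ := by simp

theorem continuous_tensorInner_self : Continuous fun A : E3 →L[ℝ] E3 => tensorInner A A := by
  unfold tensorInner
  fun_prop

theorem integrable_tensorInner_self {B : S2 → E3 →L[ℝ] E3} (hB : MemLp B 2 area) :
    Integrable (fun x => tensorInner (B x) (B x)) area := by
  refine (hB.integrable_norm_pow (by norm_num)).const_mul 3 |>.mono'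
    (continuous_tensorInner_self.comp_aestronglyMeasurable hB.aestronglyMeasurable)
    (ae_of_all _ fun x => ?_)
  rw [Real.norm_of_nonneg ((sq_nonneg _).trans (norm_sq_le_tensorInner _))]
  exact tensorInner_self_le _

theorem integral_sq_mu_le (H : SL3) {I : S2 → ℝ} (hI : MemLp I 2 area) :
    ∫ x, mu H I x ^ 2 ∂area ≤
      ‖(linEquiv H : E3 →L[ℝ] E3)‖ ^ 3 * ∫ x, I x ^ 2 ∂area := by
  rw [mu_eq]
  exact integral_comp_sphereMap_le (linEquiv H) (det_linEquiv H) (f := fun x => I x ^ 2)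
    hI.integrable_sq fun x => sq_nonneg _

theorem integral_norm_sq_pullGrad_le (L : E3 ≃L[ℝ] E3)
    (hL : LinearMap.det (L : E3 →ₗ[ℝ] E3) = 1) {g : S2 → E3} (hg : MemLp g 2 area) :
    ∫ x, ‖pullGrad L g x‖ ^ 2 ∂area ≤
      (‖(L.symm : E3 →L[ℝ] E3)‖ * ‖(L : E3 →L[ℝ] E3)‖) ^ 2 * ‖(L : E3 →L[ℝ] E3)‖ ^ 3 *
        ∫ x, ‖g x‖ ^ 2 ∂area := by
  have h1 := (hg.integrable_norm_pow (by norm_num) : Integrable (fun x => ‖g x‖ ^ 2) area)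
  have h2 := integral_comp_sphereMap_le L hL h1 fun x => sq_nonneg _
  have h3 := integrable_comp_sphereMap L hL h1
  calc ∫ x, ‖pullGrad L g x‖ ^ 2 ∂area
      ≤ ∫ x, (‖(L.symm : E3 →L[ℝ] E3)‖ * ‖(L : E3 →L[ℝ] E3)‖) ^ 2 *
          ‖g (sphereMap L x)‖ ^ 2 ∂area := by
        refine integral_mono ((memLp_pullGrad L hL hg).integrable_norm_pow (by norm_num))
          (h3.const_mul _) fun x => ?_
        simp only [← mul_pow]
        exact pow_le_pow_left₀ (norm_nonneg _) (norm_pullGrad_le L g x) 2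
    _ ≤ _ := by
        rw [integral_const_mul, mul_assoc]
        exact mul_le_mul_of_nonneg_left h2 (by positivity)

theorem tensorInner_pullHess_self_le (L : E3 ≃L[ℝ] E3) (g : S2 → E3) (B : S2 → E3 →L[ℝ] E3)
    (x : S2) : tensorInner (pullHess L g B x) (pullHess L g B x) ≤
      24 * (‖(L.symm : E3 →L[ℝ] E3)‖ * ‖(L : E3 →L[ℝ] E3)‖) ^ 4 *
        (tensorInner (B (sphereMap L x)) (B (sphereMap L x)) + ‖g (sphereMap L x)‖ ^ 2) := by
  set K := ‖(L.symm : E3 →L[ℝ] E3)‖ * ‖(L : E3 →L[ℝ] E3)‖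
  have h1 := tensorInner_self_le (pullHess L g B x)
  have h2 : _ ≤ (K ^ 2 * _) ^ 2 := pow_le_pow_left₀ (norm_nonneg _) (norm_pullHess_le L g B x) 2
  have h3 := norm_sq_le_tensorInner (B (sphereMap L x))
  -- From `(b + 2c)² ≤ 2b² + 8c²`. This 8 and the 3 of `tensorInner_self_le` give the constant 24.
  have h4 : (‖B (sphereMap L x)‖ + 2 * ‖g (sphereMap L x)‖) ^ 2 ≤
      8 * (tensorInner (B (sphereMap L x)) (B (sphereMap L x)) + ‖g (sphereMap L x)‖ ^ 2) := by
    nlinarith [sq_nonneg (‖B (sphereMap L x)‖ - 2 * ‖g (sphereMap L x)‖),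
      sq_nonneg ‖B (sphereMap L x)‖]
  rw [mul_pow, ← pow_mul, show 2 * 2 = 4 from rfl] at h2
  have h5 := mul_le_mul_of_nonneg_left h4 (by positivity : 0 ≤ K ^ 4)
  linarith [h1, h2, h5]

theorem integral_tensorInner_pullHess_le (L : E3 ≃L[ℝ] E3)
    (hL : LinearMap.det (L : E3 →ₗ[ℝ] E3) = 1) {g : S2 → E3} {B : S2 → E3 →L[ℝ] E3}
    (hg : MemLp g 2 area) (hB : MemLp B 2 area) :
    ∫ x, tensorInner (pullHess L g B x) (pullHess L g B x) ∂area ≤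
      24 * (‖(L.symm : E3 →L[ℝ] E3)‖ * ‖(L : E3 →L[ℝ] E3)‖) ^ 4 * ‖(L : E3 →L[ℝ] E3)‖ ^ 3 *
        (∫ x, tensorInner (B x) (B x) ∂area + ∫ x, ‖g x‖ ^ 2 ∂area) := by
  have h0 := (hg.integrable_norm_pow (by norm_num) : Integrable (fun x => ‖g x‖ ^ 2) area)
  have hB' := integrable_tensorInner_self hB
  have h1 : Integrable (fun x => tensorInner (B x) (B x) + ‖g x‖ ^ 2) area := hB'.add h0
  have h2 := integral_comp_sphereMap_le L hL h1 fun x =>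
    add_nonneg ((sq_nonneg _).trans (norm_sq_le_tensorInner (B x))) (sq_nonneg _)
  have h3 := integrable_comp_sphereMap L hL h1
  refine (integral_mono (integrable_tensorInner_self (memLp_pullHess L hL hg hB))
    (h3.const_mul _) (tensorInner_pullHess_self_le L g B)).trans ?_
  rw [integral_const_mul, mul_assoc _ (‖(L : E3 →L[ℝ] E3)‖ ^ 3), ← integral_add hB' h0]
  exact mul_le_mul_of_nonneg_left h2 (by positivity)

/-! ### The two actions and the theorem. -/

theorem exists_action_functions : ∃ a : SL3 → W22 → W22,
    (∀ (H : SL3) (I : W22), (a H I : S2 → ℝ) = mu H (I : S2 → ℝ)) ∧ IsRightAction a :=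
  ⟨fun H I => ⟨mu H I, mu_mem_W22 H I.2⟩, fun _ _ => rfl,
    fun _ => Subtype.ext (mu_one _), fun g h _ => Subtype.ext (mu_mu g h _)⟩

theorem memLp_mu (H : SL3) {f : S2 → ℝ} (hf : MemLp f 2 area) : MemLp (mu H f) 2 area := by
  rw [mu_eq]
  exact memLp_comp_sphereMap _ (det_linEquiv H) hf

/-- The sphere map pulls null sets back to null sets, so the result is independent of the
representative; the laws then follow from the exact ones for functions. -/
theorem exists_action_classes : ∃ a : SL3 → W22Class → W22Class,
    (∀ (H : SL3) (I : W22Class) (f : S2 → ℝ), f =ᵐ[area] ((I : Lp ℝ 2 area) : S2 → ℝ) →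
      ((a H I : Lp ℝ 2 area) : S2 → ℝ) =ᵐ[area] mu H f) ∧ IsRightAction a := by
  let a : SL3 → W22Class → W22Class := fun H I =>
    ⟨(memLp_mu H (Lp.memLp (I : Lp ℝ 2 area))).toLp _,
      mem_W22_congr (mu_mem_W22 H I.2) (MemLp.coeFn_toLp _).symm⟩
  have ha : ∀ (H : SL3) (I : W22Class) (f : S2 → ℝ), f =ᵐ[area] ((I : Lp ℝ 2 area) : S2 → ℝ) →
      ((a H I : Lp ℝ 2 area) : S2 → ℝ) =ᵐ[area] mu H f := fun H I f hf =>
    (MemLp.coeFn_toLp (memLp_mu H (Lp.memLp (I : Lp ℝ 2 area)))).trans (mu_congr_ae H hf.symm)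
  refine ⟨a, ha, fun I => ?_, fun g h I => ?_⟩
  · refine Subtype.ext (Lp.ext ?_)
    have := ha 1 I _ .rfl
    rwa [mu_one] at this
  · refine Subtype.ext (Lp.ext ?_)
    have h1 := ha g (a h I) _ (ha h I _ .rfl).symm
    rw [mu_mu] at h1
    exact h1.trans (ha (h * g) I _ .rfl).symm

end SphereSobolev

end

open SphereSobolev in
theorem lemma1 :
    -- the action on functions
    (∃ a : SL3 → W22 → W22,
      (∀ (H : SL3) (I : W22), (a H I : S2 → ℝ) = mu H (I : S2 → ℝ)) ∧ IsRightAction a) ∧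
    -- the action on classes modulo equality almost everywhere
    (∃ a : SL3 → W22Class → W22Class,
      (∀ (H : SL3) (I : W22Class) (f : S2 → ℝ), f =ᵐ[area] ((I : Lp ℝ 2 area) : S2 → ℝ) →
        ((a H I : Lp ℝ 2 area) : S2 → ℝ) =ᵐ[area] mu H f) ∧ IsRightAction a) ∧
    -- the bounds on the norms of `μ(H, I)`, of its weak gradient and of its weak Hessian
    (∀ H : SL3, ∃ M₀ > (0 : ℝ), ∃ M₁ > (0 : ℝ), ∃ M₂ > (0 : ℝ),
      ∀ I ∈ W22, ∀ (g g' : S2 → E3) (B B' : S2 → E3 →L[ℝ] E3),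
        IsWeakGradient I g → IsWeakHessian I B →
        IsWeakGradient (mu H I) g' → IsWeakHessian (mu H I) B' →
          (∫ x, mu H I x ^ 2 ∂area ≤ M₀ * ∫ x, I x ^ 2 ∂area) ∧
          (MemLp g 2 area ∧ MemLp g' 2 area ∧
            ∫ x, ‖g' x‖ ^ 2 ∂area ≤ M₁ * ∫ x, ‖g x‖ ^ 2 ∂area) ∧
          (MemLp B 2 area ∧ MemLp B' 2 area ∧
            ∫ x, tensorInner (B' x) (B' x) ∂area ≤
              M₂ * (∫ x, tensorInner (B x) (B x) ∂area + ∫ x, ‖g x‖ ^ 2 ∂area))) := by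
  refine ⟨exists_action_functions, exists_action_classes, fun H => ?_⟩
  have hL := det_linEquiv H
  have hL' := det_linEquiv_symm H
  -- Strict positivity of the constants: the operator norm dominates a positive number obtained at
  -- the point `stdVec 0`.
  have hK : 0 < ‖(linEquiv H : E3 →L[ℝ] E3)‖ :=
    (inv_pos.mpr (norm_map_pos (linEquiv H).symm (dirPoint (stdVec 0) (by simp [stdVec])))).trans_le
      (inv_norm_symm_le (linEquiv H) _)
  have hK' : 0 < ‖((linEquiv H).symm : E3 →L[ℝ] E3)‖ :=
    (inv_pos.mpr (norm_map_pos (linEquiv H) (dirPoint (stdVec 0) (by simp [stdVec])))).trans_le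
      (inv_norm_map_le (linEquiv H) _)
  refine ⟨_, pow_pos hK 3, _, mul_pos (pow_pos (mul_pos hK' hK) 2) (pow_pos hK 3), _,
    mul_pos (mul_pos (by norm_num : (0 : ℝ) < 24) (pow_pos (mul_pos hK' hK) 4)) (pow_pos hK 3),
    fun I hI g g' B B' hg hB hg' hB' => ?_⟩
  -- Membership in `W22` provides some square-integrable derivatives `g₀`, `B₀`; uniqueness
  -- transfers integrability to the given `g`, `B`, and identifies `g'`, `B'` with the pull-backs.
  obtain ⟨hI2, ⟨g₀, hg₀, hg₀2⟩, B₀, hB₀, hB₀2⟩ := hI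
  have hg2 : MemLp g 2 area := (memLp_congr_ae (hg₀.ae_eq hg)).1 hg₀2
  have hB2 : MemLp B 2 area := (memLp_congr_ae (hB₀.ae_eq hB)).1 hB₀2
  have hgp := hg.comp_sphereMap (linEquiv H) hL hL'
  have hBp := IsWeakHessian.comp_sphereMap (linEquiv H) hL hL' hg hB
  rw [← mu_eq] at hgp hBp
  have eg := hgp.ae_eq hg'
  have eB := hBp.ae_eq hB'
  refine ⟨integral_sq_mu_le H hI2, ⟨hg2, (memLp_congr_ae eg).1 (memLp_pullGrad _ hL hg2), ?_⟩,
    hB2, (memLp_congr_ae eB).1 (memLp_pullHess _ hL hg2 hB2), ?_⟩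
  · refine le_trans (le_of_eq (integral_congr_ae ?_))
      (integral_norm_sq_pullGrad_le (linEquiv H) hL hg2)
    filter_upwards [eg] with x hx
    rw [hx]
  · refine le_trans (le_of_eq (integral_congr_ae ?_))
      (integral_tensorInner_pullHess_le (linEquiv H) hL hg2 hB2)
    filter_upwards [eB] with x hx
    rw [hx]
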